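/- Let $\mathbb D=\{|z|\le 1\}\subset\mathbb C$ be the unit disk with the Euclidean metric $g$, $d(z)=1-|z|^2$, $\gamma\in(-1,1)$, and $L^2_\gamma(\mathbb D)=L^2(\mathbb D,d^\gamma\,dx\,dy)$. Oriented chords are parametrized by fan-beam coordinates $(\beta,\alpha)\in(\mathbb R/2\pi\mathbb Z)\times[-\frac\pi2,\frac\pi2]$ through $z_{\beta,\alpha}(t)=e^{i\beta}+te^{i(\beta+\alpha+\pi)}$, $0\le t\le 2\cos\alpha$. Put $\mu=\cos\alpha$ and let $L^2_\gamma=L^2(\mu^{-2\gamma}d\beta\,d\alpha)$ be the data space, with pairing $(u,v)_{L^2_\gamma}=\int_0^{2\pi}\!\int_{-\pi/2}^{\pi/2}u\,\overline v\,\mu^{-2\gamma}\,d\alpha\,d\beta$. For a complex-valued symmetric $m$-tensor field $f$ with components in $L^2_\gamma(\mathbb D)$ let $$I_md^\gamma f(\beta,\alpha)=\int_0^{2\cos\alpha}f_{z_{\beta,\alpha}(t)}(\dot z_{\beta,\alpha}(t),\dots,\dot z_{\beta,\alpha}(t))\,d(z_{\beta,\alpha}(t))^\gamma\,dt .$$ Let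 $LT=\sigma(g\otimes T)$, with $\sigma$ the symmetrization, and let $\star dx=dy$, $\star dy=-dx$. A tt field of order $k\ge1$ is a field $a\,dz^k+b\,d\bar z^k$ with $a,b\in L^2_\gamma(\mathbb D)$, $a$ analytic and $b$ antianalytic in the open disk. A tensor field $f$ is in iterated-tt form with modes $f_k$ if * ($m=2p$, $p\ge 0$) $f=\sum_{j=0}^pL^{p-j}f_{2j}$ with $f_0\in L^2_\gamma(\mathbb D)$ and $f_{2j}$ a tt field of order $2j$ for $1\le j\le p$; * ($m=2p+1$, $p\ge0$) $f=L^p(d^{-\gamma}{\star}dh)+\sum_{j=0}^pL^{p-j}f_{2j+1}$ with $f_{2j+1}$ a tt field of order $2j+1$ for $0\le j\le p$, and $h\in H_0^{1,-\gamma}(\mathbb D)$, the completion of the smooth functions with compact support in the open disk for the norm $(\|u\|^2_{L^2_{-\gamma}}+\|\nabla u\|^2_{L^2_{-\gamma}})^{1/2}$. For integers $j\ge0$ and $|z|<1$ define, with the principal power, $$G^\gamma_{2j}(\beta,\alpha;z)=\frac{\mu^{2\gamma+1}e^{2ji(\beta+\alpha+\pi)}}{2\pi^2}\;\frac{(\gamma+1)\,(1+e^{i(2\beta+2\alpha)}\bar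 z^2)}{\big((1-e^{i\beta}\bar z)(1-e^{i(\beta+2\alpha+\pi)}\bar z)\big)^{\gamma+2}} .$$ **Theorem (Reconstruction of the tt modes).** Let $f$ be a symmetric $m$-tensor field in iterated-tt form and $\mathcal D=I_md^\gamma f$. Then $\mathcal D\in L^2_\gamma$, the functions $G^\gamma_{2j}(\cdot,\cdot;z)$ (if $m=2p$, $1\le j\le p$), respectively $e^{i(\beta+\alpha+\pi)}G^\gamma_{2j}(\cdot,\cdot;z)$ (if $m=2p+1$, $0\le j\le p$), belong to $L^2_\gamma$ for every $|z|<1$, and, for every $|z|<1$: * if $m=2p$, for $1\le j\le p$, $$f_{2j}(z)=(\mathcal D,G^\gamma_{2j}(\cdot,\cdot;z))_{L^2_\gamma}\,dz^{2j}+(\mathcal D,\overline{G^\gamma_{2j}(\cdot,\cdot;z)})_{L^2_\gamma}\,d\bar z^{2j};$$ * if $m=2p+1$, for $0\le j\le p$, $$f_{2j+1}(z)=(\mathcal D,e^{i(\beta+\alpha+\pi)}G^\gamma_{2j}(\cdot,\cdot;z))_{L^2_\gamma}\,dz^{2j+1}+(\mathcal D,\overline{e^{i(\beta+\alpha+\pi)}G^\gamma_{2j}(\cdot,\cdot;z)})_{L^2_\gamma}\,d\bar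 z^{2j+1}.$$ -/

import Mathlib

open MeasureTheory Filter Topology
open scoped ContDiff ComplexConjugate

noncomputable section

namespace DiskTensor

/-! The disk is the unit disk of the complex plane, `z = x + i y`; tangent vectors are complex
numbers, the Euclidean metric is `g (v, w) = Re (conj v * w)`. All tensors are complex-valued. -/

/-- Covariant tensors of order `m` at a point: real-multilinear maps from `m` tangent vectors
to `ℂ`. -/
abbrev Tensor (m : ℕ) : Type := MultilinearMap ℝ (fun _ : Fin m => ℂ) ℂ

/-- Tensor fields of order `m`; only their restriction to the open unit disk matters. -/
abbrev TensorField (m : ℕ) : Type := ℂ → Tensor m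

/-- The boundary defining function `d(z) = 1 - |z|^2`. -/
def bdf (z : ℂ) : ℝ := 1 - ‖z‖ ^ 2

/-- The measure `d^γ dx dy` on the unit disk (the boundary circle is a null set). -/
def diskMeasure (γ : ℝ) : Measure ℂ :=
  (volume.restrict (Metric.ball (0 : ℂ) 1)).withDensity fun z => ENNReal.ofReal (bdf z ^ γ)

/-- The measure `μ^(-2γ) dβ dα`, `μ = cos α`, on the inward boundary in fan-beam coordinates
`(β, α)`, the circle of `β` being represented by `(0, 2π]`. -/
def fanMeasure (γ : ℝ) : Measure (ℝ × ℝ) :=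
  (volume.restrict (Set.Ioc 0 (2 * Real.pi) ×ˢ Set.Icc (-(Real.pi / 2)) (Real.pi / 2))).withDensity
    fun q => ENNReal.ofReal (Real.cos q.2 ^ (-2 * γ))

/-- The pairing of `L²(μ^(-2γ) dβ dα)`, linear in the first and conjugate-linear in the second
argument. -/
def fanPairing (γ : ℝ) (u v : ℝ × ℝ → ℂ) : ℂ := ∫ q, u q * conj (v q) ∂(fanMeasure γ)

/-- The direction angle `θ = β + α + π` of the line with fan-beam coordinates `q = (β, α)`. -/
def angle (q : ℝ × ℝ) : ℝ := q.1 + q.2 + Real.pi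

/-- The unit-speed line `t ↦ e^{iβ} + t e^{i(β+α+π)}`. -/
def line (q : ℝ × ℝ) (t : ℝ) : ℂ :=
  Complex.exp (Complex.I * q.1) + t * Complex.exp (Complex.I * angle q)

/-- The weighted X-ray transform `I_m d^γ f`: the integral along the chord of
`f_z(v, …, v) d(z)^γ`, where `v` is the velocity. For a field with components in `L²(d^γ)` the
integral converges for almost every chord and defines the continuous extension of the transform. -/
def xray (γ : ℝ) {m : ℕ} (f : TensorField m) (q : ℝ × ℝ) : ℂ :=
  ∫ t in (0 : ℝ)..(2 * Real.cos q.2),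
    f (line q t) (fun _ => Complex.exp (Complex.I * angle q)) * ((bdf (line q t) ^ γ : ℝ) : ℂ)

/-- All components of the tensor field lie in `L²(d^γ)`. -/
def TensorField.IsL2 (γ : ℝ) {m : ℕ} (f : TensorField m) : Prop :=
  ∀ v : Fin m → ℂ, MemLp (fun z => f z v) 2 (diskMeasure γ)

/-- Complex conjugation as a real-linear map. -/
def conjLin : ℂ →ₗ[ℝ] ℂ := Complex.conjAe.toLinearMap

/-- `dz^m`, that is `(v₁, …, v_m) ↦ v₁ ⋯ v_m`. -/
def dzPow (m : ℕ) : Tensor m := MultilinearMap.mkPiAlgebra ℝ (Fin m) ℂ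

/-- `dz̄^m`, that is `(v₁, …, v_m) ↦ conj v₁ ⋯ conj v_m`. -/
def dzbarPow (m : ℕ) : Tensor m := (dzPow m).compLinearMap fun _ => conjLin

/-- The Euclidean metric as a tensor of order two. -/
def metric : Tensor 2 where
  toFun v := (((conj (v 0) * v 1).re : ℝ) : ℂ)
  map_update_add' := by
    intro inst v i x y
    rw [Subsingleton.elim inst (instDecidableEqFin 2)]
    fin_cases i <;> simp [Function.update] <;> ring
  map_update_smul' := by
    intro inst v i c x
    rw [Subsingleton.elim inst (instDecidableEqFin 2)]
    fin_cases i <;> simp [Function.update] <;> ring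

/-- The tensor product `(S ⊗ T)(v₁, …, v_{m+n}) = S(v₁, …, v_m) T(v_{m+1}, …, v_{m+n})`. -/
def tmul {m n : ℕ} (S : Tensor m) (T : Tensor n) : Tensor (m + n) :=
  (LinearMap.mul' ℝ ℂ).compMultilinearMap ((S.domCoprod T).domDomCongr finSumFinEquiv)

/-- Symmetrization. -/
def symmetrize {m : ℕ} (T : Tensor m) : Tensor m :=
  ((m.factorial : ℝ)⁻¹) • ∑ s : Equiv.Perm (Fin m), T.domDomCongr s

/-- Change of the index type along an equality of orders. -/
def castOrder {m n : ℕ} (h : m = n) (T : Tensor m) : Tensor n := T.domDomCongr (finCongr h)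

/-- The symmetric product with the metric, `L T = σ (g ⊗ T)`. -/
def symMetric {m : ℕ} (T : Tensor m) : Tensor (m + 2) :=
  symmetrize (castOrder (Nat.add_comm 2 m) (tmul metric T))

/-- The iterates `L^k`. -/
def symMetricPow {m : ℕ} (T : Tensor m) : (k : ℕ) → Tensor (m + 2 * k)
  | 0 => T
  | k + 1 => symMetric (symMetricPow T k)

/-- `L^k` applied to a tensor of order `m`, with the resulting order `m + 2 k` named `n`. -/
def raise {m n : ℕ} (k : ℕ) (h : m + 2 * k = n) (T : Tensor m) : Tensor n :=
  castOrder h (symMetricPow T k)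

/-- The field is `a dz^m + b dz̄^m` on the open disk, with `a` analytic, `b` antianalytic and both
in `L²(d^γ)`. -/
def TensorField.IsTT (γ : ℝ) {m : ℕ} (f : TensorField m) : Prop :=
  ∃ a b : ℂ → ℂ,
    DifferentiableOn ℂ a (Metric.ball 0 1) ∧ MemLp a 2 (diskMeasure γ) ∧
    DifferentiableOn ℂ (fun z => conj (b z)) (Metric.ball 0 1) ∧ MemLp b 2 (diskMeasure γ) ∧
    ∀ z ∈ Metric.ball (0 : ℂ) 1, f z = a z • dzPow m + b z • dzbarPow m

/-- `h` lies in the completion of the smooth functions with compact support in the open disk for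
the norm `(‖u‖² + ‖∇u‖²)^(1/2)` of `L²(d^s)`, and `dh` is its differential: both are the
limits, in `L²(d^s)`, of a sequence of such functions and of their differentials. -/
def IsH01 (s : ℝ) (h : ℂ → ℂ) (dh : ℂ → ℂ →L[ℝ] ℂ) : Prop :=
  MemLp h 2 (diskMeasure s) ∧ MemLp dh 2 (diskMeasure s) ∧
  ∃ u : ℕ → ℂ → ℂ,
    (∀ n, ContDiff ℝ ∞ (u n) ∧ HasCompactSupport (u n) ∧
      tsupport (u n) ⊆ Metric.ball (0 : ℂ) 1) ∧
    Tendsto (fun n => eLpNorm (fun z => u n z - h z) 2 (diskMeasure s)) atTop (𝓝 0) ∧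
    Tendsto (fun n => eLpNorm (fun z => fderiv ℝ (u n) z - dh z) 2 (diskMeasure s)) atTop (𝓝 0)

/-- The Hodge star of a one-form, `⋆dx = dy`, `⋆dy = -dx`; equivalently
`(⋆η)(v) = η(-i v)`. -/
def hodge (η : ℂ →L[ℝ] ℂ) : Tensor 1 :=
  MultilinearMap.ofSubsingleton ℝ ℂ ℂ (0 : Fin 1)
    (η.toLinearMap ∘ₗ LinearMap.mulLeft ℝ (-Complex.I))

/-- `f` is a tensor field of order `2p` in iterated-tt form with modes `F 0, …, F p` of orders
`0, 2, …, 2p`: `f = ∑_{j ≤ p} L^{p-j} F_j`, with `F_0` in `L²(d^γ)` and `F_j` a tt field for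
`1 ≤ j ≤ p`. -/
def IsIteratedTTEven (γ : ℝ) (p : ℕ) (f : TensorField (2 * p))
    (F : (j : ℕ) → TensorField (2 * j)) : Prop :=
  (F 0).IsL2 γ ∧ (∀ j, 1 ≤ j → j ≤ p → (F j).IsTT γ) ∧
  ∀ᵐ z ∂(diskMeasure γ),
    f z = ∑ j : Fin (p + 1), raise (p - (j : ℕ)) (by have := j.isLt; omega) (F j z)

/-- `f` is a tensor field of order `2p+1` in iterated-tt form with modes `F 0, …, F p` of orders
`1, 3, …, 2p+1`: `f = L^p (d^{-γ} ⋆dh) + ∑_{j ≤ p} L^{p-j} F_j`, with `h` in the weighted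
Sobolev space with weight `d^{-γ}` and each `F_j` a tt field. -/
def IsIteratedTTOdd (γ : ℝ) (p : ℕ) (f : TensorField (2 * p + 1))
    (F : (j : ℕ) → TensorField (2 * j + 1)) : Prop :=
  (∀ j, j ≤ p → (F j).IsTT γ) ∧
  ∃ (h : ℂ → ℂ) (dh : ℂ → ℂ →L[ℝ] ℂ), IsH01 (-γ) h dh ∧
  ∀ᵐ z ∂(diskMeasure γ),
    f z = raise p (by omega) (((bdf z ^ (-γ) : ℝ) : ℂ) • hodge (dh z))
      + ∑ j : Fin (p + 1), raise (p - (j : ℕ)) (by have := j.isLt; omega) (F j z)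

/-- The reconstruction kernel
`G_{2j}(β, α; z) = μ^{2γ+1} e^{2ji(β+α+π)} / (2π²) * (γ+1) (1 + e^{i(2β+2α)} z̄²)
  / ((1 - e^{iβ} z̄) (1 - e^{i(β+2α+π)} z̄))^{γ+2}`, `μ = cos α`, with the principal power (for
`|z| < 1` the base is a product of two numbers of positive real part). -/
def kernel (γ : ℝ) (j : ℕ) (z : ℂ) (q : ℝ × ℝ) : ℂ :=
  ((Real.cos q.2 ^ (2 * γ + 1) : ℝ) : ℂ) * Complex.exp (2 * j * Complex.I * angle q)
      / (2 * (Real.pi : ℂ) ^ 2)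
    * (((γ : ℂ) + 1) * (1 + Complex.exp (Complex.I * (2 * q.1 + 2 * q.2)) * conj z ^ 2)
      / ((1 - Complex.exp (Complex.I * q.1) * conj z)
          * (1 - Complex.exp (Complex.I * (q.1 + 2 * q.2 + Real.pi)) * conj z)) ^ ((γ : ℂ) + 2))

/-- The kernel for odd orders, `e^{i(β+α+π)} G_{2j}(β, α; z)`. -/
def kernelOdd (γ : ℝ) (j : ℕ) (z : ℂ) (q : ℝ × ℝ) : ℂ :=
  Complex.exp (Complex.I * angle q) * kernel γ j z q

end DiskTensor

end

/-!
The transform is a pairing on the circle bundle of the disk. A tensor field `f` gives the function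
`(w, v) ↦ f_w (v, …, v)` of a point and a unit direction, and Santaló's formula
(`measurePreserving_flow`) says that moving along the chords carries `μ d^γ dt dα dβ` to the product
of `d^γ dx dy` with the arc length of directions. With the Cauchy–Schwarz inequality on each chord,
whose total weight is a multiple of `μ^{2γ+1}`, this gives the boundedness of the transform
(`memLp_bundleXray`). It also turns the pairing of the data with the reconstruction kernel into an
integral on the circle bundle (`fanPairing_bundleXray`): up to the factor `μ^{2γ+1}`, the kernel is
constant along chords, being the restriction (`kernel_eq`) of `v^n κ_z(w, v)`, where
`κ_z = (γ + 1) / (2 π²) (1 + v² z̄²) / b^{γ+2}` and `b = 1 - w z̄ + v² z̄ (w̄ - z̄)`.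

The essential point is that the kernel reproduces analytic functions for each fixed direction,
without averaging (`integral_mul_conj_bundleKernel`):
`∫ a(w) conj (κ_z(w, v)) d^γ dx dy = a(z) / (2 π)`. Indeed, for analytic `a`, the integrand times
`z - w` is, up to a constant, the derivative `∂/∂w̄` of
`a(w) (1 + v̄² z²) / (1 + v̄² z w) (d / b̄)^{γ+1}`, a function that vanishes on the boundary circle and
equals `a(z)` at `w = z`; the formula is then that of Cauchy and Pompeiu. Consequently a mode
`a(w) v^m` with `m ≠ n` is orthogonal to `v^n κ_z`, and the one with `m = n` is paired to `a(z)`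
(`modePairing_analytic`).

All other contributions vanish. The kernel is analytic in `v` in the closed unit disk, hence has
no negative Fourier modes, so `g(w) v̄^m` is annihilated for every `g` when `m + n ≥ 1`
(`modePairing_conj_pow`); this takes care of the antianalytic parts and of the mode of order zero.
For the potential part `d^{-γ} ⋆dh` what remains is the integral of `∂h/∂w` against a conjugate
bounded analytic function, which vanishes by an integration by parts for test functions, and by
density in general (`modePairing_potential`). Since symmetrized products with the metric do not
change the values on unit vectors, the analytic parts of the modes are recovered; the antianalytic
parts follow by complex conjugation of the field (`fanPairing_modes_both`).
-/

noncomputable section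

namespace DiskTensor

/-! ### Santaló's formula -/

/-- The arc length measure of the unit circle, as a measure on `ℂ`. -/
def dirMeasure : Measure ℂ :=
  (volume.restrict (Set.Ioc 0 (2 * Real.pi))).map fun θ : ℝ => Complex.exp (Complex.I * θ)

/-- The unit direction `e^{iθ}` of the line with fan-beam coordinates `q`. -/
def dir (q : ℝ × ℝ) : ℂ := Complex.exp (Complex.I * angle q)

lemma measurable_expI : Measurable fun θ : ℝ => Complex.exp (Complex.I * θ) := by
  fun_prop

lemma expI_periodic (θ : ℝ) (k : ℤ) :
    Complex.exp (Complex.I * ((θ + k * (2 * Real.pi) : ℝ) : ℂ)) = Complex.exp (Complex.I * θ) := by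
  have h := Complex.exp_periodic.int_mul k (Complex.I * θ)
  rw [← h]
  push_cast
  ring_nf

lemma norm_expI (θ : ℝ) : ‖Complex.exp (Complex.I * θ)‖ = 1 := by
  rw [mul_comm]; exact Complex.norm_exp_ofReal_mul_I θ

/-- A point of a line in terms of its direction `v` and the fan angle `α`:
it is `v (t - e^{-iα})`. -/
lemma line_eq (q : ℝ × ℝ) (t : ℝ) :
    line q t = dir q * (t - Complex.exp (Complex.I * ((-q.2 : ℝ) : ℂ))) := by
  have h : Complex.exp (Complex.I * q.1)
      = -(dir q * Complex.exp (Complex.I * ((-q.2 : ℝ) : ℂ))) := by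
    rw [dir, ← Complex.exp_add]
    have : Complex.I * (angle q : ℂ) + Complex.I * ((-q.2 : ℝ) : ℂ)
        = Complex.I * q.1 + Real.pi * Complex.I := by
      simp only [angle]; push_cast; ring
    rw [this, Complex.exp_add, Complex.exp_pi_mul_I]; ring
  rw [line, h, ← dir]; ring

lemma sub_exp_eq (t α : ℝ) :
    (t : ℂ) - Complex.exp (Complex.I * ((-α : ℝ) : ℂ))
      = ((t - Real.cos α : ℝ) : ℂ) + Real.sin α * Complex.I := by
  rw [mul_comm, Complex.exp_mul_I]
  push_cast
  rw [Complex.cos_neg, Complex.sin_neg]; ring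

/-- Integrals of periodic functions over a period, with a shift of the variable. -/
lemma setLIntegral_periodic_shift (G : ℝ → ENNReal)
    (hG : ∀ (θ : ℝ) (k : ℤ), G (θ + k * (2 * Real.pi)) = G θ) (c : ℝ) :
    ∫⁻ β in Set.Ioc 0 (2 * Real.pi), G (β + c) = ∫⁻ θ in Set.Ioc 0 (2 * Real.pi), G θ := by
  have h1 : ∫⁻ β in Set.Ioc 0 (2 * Real.pi), G (β + c)
      = ∫⁻ θ in Set.Ioc c (c + 2 * Real.pi), G θ := by
    have := (measurePreserving_add_right (volume : Measure ℝ) c).setLIntegral_comp_preimage_emb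
      (MeasurableEquiv.addRight c).measurableEmbedding G (Set.Ioc c (c + 2 * Real.pi))
    rw [← this]
    congr 2
    ext x; simp [add_comm]
  rw [h1]
  have h2 := (isAddFundamentalDomain_Ioc Real.two_pi_pos c).setLIntegral_eq
    (isAddFundamentalDomain_Ioc Real.two_pi_pos 0) G (by
      rintro ⟨g, hg⟩ x
      obtain ⟨k, rfl⟩ := AddSubgroup.mem_zmultiples_iff.1 hg
      rw [AddSubgroup.vadd_def, vadd_eq_add, add_comm]
      simpa using hG x k)
  rw [h2, zero_add]

/-- The disk is swept by parallel chords: the coordinates `(t, α) ↦ t - e^{-iα}` have Jacobian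
`cos α`. -/
lemma lintegral_ball_eq_parallel (Φ : ℂ → ENNReal) (hΦ : Measurable Φ) :
    ∫⁻ α in Set.Icc (-(Real.pi / 2)) (Real.pi / 2), ∫⁻ t in Set.Ioo 0 (2 * Real.cos α),
        ENNReal.ofReal (Real.cos α) * Φ (t - Complex.exp (Complex.I * ((-α : ℝ) : ℂ)))
      = ∫⁻ w in Metric.ball (0 : ℂ) 1, Φ w := by
  set Ψ : ℂ → ENNReal := (Metric.ball (0 : ℂ) 1).indicator Φ with hΨ
  have hΨm : Measurable Ψ := hΦ.indicator measurableSet_ball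
  set H : ℝ → ENNReal := fun y => ∫⁻ x : ℝ, Ψ (x + y * Complex.I) with hH
  have hball : ∀ x y : ℝ, ((x : ℂ) + y * Complex.I ∈ Metric.ball (0 : ℂ) 1) ↔ x ^ 2 + y ^ 2 < 1 := by
    intro x y
    rw [mem_ball_zero_iff, ← sq_lt_one_iff₀ (norm_nonneg _), ← Complex.normSq_eq_norm_sq,
      Complex.normSq_add_mul_I]
  have h1 : ∫⁻ w in Metric.ball (0 : ℂ) 1, Φ w = ∫⁻ y in Set.Ioo (-1 : ℝ) 1, H y := by
    rw [← lintegral_indicator measurableSet_ball]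
    rw [← Complex.volume_preserving_equiv_real_prod.symm.lintegral_comp hΨm]
    rw [Measure.volume_eq_prod, lintegral_prod_symm]
    · rw [← lintegral_indicator measurableSet_Ioo]
      congr 1 with y
      by_cases hy : y ∈ Set.Ioo (-1 : ℝ) 1
      · rw [Set.indicator_of_mem hy]
        simp only [hH]
        congr 1 with x
        congr 1
        apply Complex.ext <;> simp [Complex.measurableEquivRealProd]
      · rw [Set.indicator_of_notMem hy]
        rw [lintegral_eq_zero_iff']
        · refine ae_of_all _ fun x => ?_
          have : ((x : ℂ) + y * Complex.I) ∉ Metric.ball (0 : ℂ) 1 := by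
            rw [hball]; intro hlt; apply hy; constructor <;> nlinarith [sq_nonneg x]
          have e : Complex.measurableEquivRealProd.symm (x, y) = (x : ℂ) + y * Complex.I := by
            apply Complex.ext <;> simp [Complex.measurableEquivRealProd]
          change Ψ (Complex.measurableEquivRealProd.symm (x, y)) = 0
          rw [e]
          exact Set.indicator_of_notMem this _
        · exact (hΨm.comp (Complex.measurableEquivRealProd.symm.measurable.comp
            (by fun_prop))).aemeasurable
    · exact (hΨm.comp Complex.measurableEquivRealProd.symm.measurable).aemeasurable
  have himg : Real.sin '' Set.Ioo (-(Real.pi / 2)) (Real.pi / 2) = Set.Ioo (-1) 1 := by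
    ext y; constructor
    · rintro ⟨x, hx, rfl⟩
      have hc := Real.cos_pos_of_mem_Ioo hx
      constructor <;> nlinarith [Real.sin_sq_add_cos_sq x]
    · intro hy
      exact ⟨Real.arcsin y, ⟨Real.neg_pi_div_two_lt_arcsin.2 hy.1, Real.arcsin_lt_pi_div_two.2 hy.2⟩,
        Real.sin_arcsin hy.1.le hy.2.le⟩
  -- The height of a horizontal chord is `sin α`, which gives the factor `cos α`; on the chord,
  -- `t - cos α` is the abscissa.
  rw [h1, ← himg, lintegral_image_eq_lintegral_abs_deriv_mul measurableSet_Ioo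
    (fun x _ => (Real.hasDerivAt_sin x).hasDerivWithinAt)
    (Real.strictMonoOn_sin.injOn.mono Set.Ioo_subset_Icc_self)]
  rw [← restrict_Ioo_eq_restrict_Icc]
  refine setLIntegral_congr_fun measurableSet_Ioo fun α hα => ?_
  have hc := Real.cos_pos_of_mem_Ioo hα
  have hs := Real.sin_sq_add_cos_sq α
  rw [abs_of_pos hc, lintegral_const_mul _ (by fun_prop)]
  congr 1
  simp only [hH]
  rw [← lintegral_indicator measurableSet_Ioo]
  conv_rhs => rw [← lintegral_sub_right_eq_self _ (Real.cos α)]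
  congr 1 with t
  rw [← sub_exp_eq]
  by_cases ht : t ∈ Set.Ioo 0 (2 * Real.cos α)
  · rw [Set.indicator_of_mem ht, hΨ, Set.indicator_of_mem]
    rw [sub_exp_eq, hball]; nlinarith [ht.1, ht.2]
  · rw [Set.indicator_of_notMem ht, hΨ, Set.indicator_of_notMem]
    rw [sub_exp_eq, hball]
    intro h
    apply ht
    constructor <;> by_contra hh <;> push Not at hh <;> nlinarith

/-- Santaló's formula for nonnegative functions of a point and a direction. -/
lemma lintegral_santalo (Ψ : ℂ × ℂ → ENNReal) (hΨ : Measurable Ψ) :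
    ∫⁻ q in Set.Ioc 0 (2 * Real.pi) ×ˢ Set.Icc (-(Real.pi / 2)) (Real.pi / 2),
      ∫⁻ t in Set.Ioo 0 (2 * Real.cos q.2), ENNReal.ofReal (Real.cos q.2) * Ψ (line q t, dir q)
      = ∫⁻ θ in Set.Ioc 0 (2 * Real.pi), ∫⁻ w in Metric.ball (0 : ℂ) 1,
          Ψ (w, Complex.exp (Complex.I * (θ : ℝ))) := by
  set G : ℝ → ℝ → ENNReal := fun α θ => ∫⁻ t in Set.Ioo 0 (2 * Real.cos α),
    ENNReal.ofReal (Real.cos α) * Ψ (Complex.exp (Complex.I * θ) *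
      (t - Complex.exp (Complex.I * ((-α : ℝ) : ℂ))), Complex.exp (Complex.I * θ)) with hG
  have hGm : Measurable fun q : ℝ × ℝ => G q.1 q.2 := by
    have : (fun q : ℝ × ℝ => G q.1 q.2) = fun q => ∫⁻ t, {p : (ℝ × ℝ) × ℝ | 0 < p.2 ∧
        p.2 < 2 * Real.cos p.1.1}.indicator (fun p => ENNReal.ofReal (Real.cos p.1.1) *
        Ψ (Complex.exp (Complex.I * p.1.2) * (p.2 - Complex.exp (Complex.I * ((-p.1.1 : ℝ) : ℂ))),
          Complex.exp (Complex.I * p.1.2))) (q, t) := by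
      funext q
      simp only [hG]
      rw [← lintegral_indicator measurableSet_Ioo]
      rfl
    rw [this]
    refine Measurable.lintegral_prod_right' (f := Set.indicator _ _) ?_
    refine Measurable.indicator ?_ ?_
    · refine Measurable.mul (by fun_prop) (hΨ.comp (by fun_prop))
    · exact (measurableSet_lt measurable_const measurable_snd).inter
        (measurableSet_lt measurable_snd (by fun_prop))
  have hper : ∀ α θ (k : ℤ), G α (θ + k * (2 * Real.pi)) = G α θ := by
    intro α θ k
    simp only [hG, expI_periodic]
  have h0 : ∀ q : ℝ × ℝ, ∫⁻ t in Set.Ioo 0 (2 * Real.cos q.2),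
      ENNReal.ofReal (Real.cos q.2) * Ψ (line q t, dir q) = G q.2 (q.1 + (q.2 + Real.pi)) := by
    intro q
    simp only [hG, line_eq, dir, angle, add_assoc]
  -- For fixed `α` the direction angle `θ = β + α + π` replaces `β`; for fixed `θ` the chords are then
  -- a rotated copy of the horizontal ones.
  simp only [h0]
  rw [Measure.volume_eq_prod, ← Measure.prod_restrict, lintegral_prod_symm]
  · simp only [setLIntegral_periodic_shift _ (hper _)]
    rw [lintegral_lintegral_swap hGm.aemeasurable]
    refine lintegral_congr fun θ => ?_
    simp only [hG]
    rw [lintegral_ball_eq_parallel (fun w => Ψ (Complex.exp (Complex.I * θ) * w,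
      Complex.exp (Complex.I * θ))) (hΨ.comp (by fun_prop))]
    let c : Circle := ⟨Complex.exp (Complex.I * θ), by
      rw [Submonoid.unitSphere, Submonoid.mem_mk]; simp⟩
    have := (rotation c).measurePreserving.setLIntegral_comp_preimage
      (s := Metric.ball 0 1) measurableSet_ball
      (f := fun w => Ψ (w, Complex.exp (Complex.I * θ))) (hΨ.comp (by fun_prop))
    rw [← this]
    have hpre : (rotation c) ⁻¹' Metric.ball 0 1 = Metric.ball 0 1 := by
      ext x
      rw [Set.mem_preimage, mem_ball_zero_iff, mem_ball_zero_iff, LinearIsometryEquiv.norm_map]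
    rw [hpre]
    rfl
  · exact (hGm.comp (f := fun q : ℝ × ℝ => (q.2, q.1 + (q.2 + Real.pi))) (by fun_prop)).aemeasurable

/-! ### The X-ray transform of functions on the circle bundle -/

/-- The fan-beam coordinates of all chords. -/
def fanSet : Set (ℝ × ℝ) := Set.Ioc 0 (2 * Real.pi) ×ˢ Set.Icc (-(Real.pi / 2)) (Real.pi / 2)

/-- The point and the direction reached at time `t` along the line `q`. -/
def flow (p : (ℝ × ℝ) × ℝ) : ℂ × ℂ := (line p.1 p.2, dir p.1)

/-- The times at which the lines are inside the disk. -/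
def raySet : Set ((ℝ × ℝ) × ℝ) := {p | 0 < p.2 ∧ p.2 < 2 * Real.cos p.1.2}

/-- The density `μ d^γ` on the set of interior points of chords. -/
def rayDensity (γ : ℝ) : (ℝ × ℝ) × ℝ → NNReal :=
  raySet.indicator fun p => Real.toNNReal (Real.cos p.1.2 * bdf (line p.1 p.2) ^ γ)

/-- The measure `μ d^γ dt dα dβ` on chords with a marked point. -/
def rayMeasure (γ : ℝ) : Measure ((ℝ × ℝ) × ℝ) :=
  ((volume.restrict fanSet).prod volume).withDensity fun p => (rayDensity γ p : ENNReal)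

/-- The weighted X-ray transform of a function of a point and a direction. -/
def bundleXray (γ : ℝ) (Φ : ℂ × ℂ → ℂ) (q : ℝ × ℝ) : ℂ :=
  ∫ t in (0 : ℝ)..(2 * Real.cos q.2), Φ (line q t, dir q) * ((bdf (line q t) ^ γ : ℝ) : ℂ)

lemma bdf_line (q : ℝ × ℝ) (t : ℝ) : bdf (line q t) = t * (2 * Real.cos q.2 - t) := by
  rw [bdf, line_eq, norm_mul, dir, norm_expI, one_mul, sub_exp_eq, ← Complex.normSq_eq_norm_sq,
    Complex.normSq_add_mul_I]
  linear_combination - Real.sin_sq_add_cos_sq q.2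

lemma measurable_bdf : Measurable bdf := by
  unfold bdf; fun_prop

lemma measurable_flow : Measurable flow := by
  unfold flow line dir angle; fun_prop

lemma measurableSet_raySet : MeasurableSet raySet :=
  (measurableSet_lt measurable_const measurable_snd).inter
    (measurableSet_lt measurable_snd (by fun_prop))

lemma measurable_rayDensity (γ : ℝ) : Measurable (rayDensity γ) := by
  refine Measurable.indicator ?_ measurableSet_raySet
  refine Measurable.real_toNNReal (Measurable.mul (by fun_prop) (Measurable.pow_const ?_ _))
  exact measurable_bdf.comp (measurable_fst.comp measurable_flow)

instance (γ : ℝ) : SFinite (diskMeasure γ) := by unfold diskMeasure; infer_instance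

instance : IsFiniteMeasure dirMeasure := by unfold dirMeasure; infer_instance

lemma bdf_pos_of_mem_raySet {p : (ℝ × ℝ) × ℝ} (hp : p ∈ raySet) : 0 < bdf (line p.1 p.2) := by
  rw [bdf_line]; exact mul_pos hp.1 (by linarith [hp.2])

lemma cos_pos_of_mem_raySet {p : (ℝ × ℝ) × ℝ} (hp : p ∈ raySet) : 0 < Real.cos p.1.2 := by
  linarith [hp.1, hp.2]

lemma bdf_pos_iff {w : ℂ} : 0 < bdf w ↔ w ∈ Metric.ball (0 : ℂ) 1 := by
  rw [bdf, sub_pos, sq_lt_one_iff₀ (norm_nonneg _), mem_ball_zero_iff]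

lemma lintegral_diskMeasure (γ : ℝ) (Φ : ℂ → ENNReal) (hΦ : Measurable Φ) :
    ∫⁻ w, Φ w ∂(diskMeasure γ)
      = ∫⁻ w in Metric.ball (0 : ℂ) 1, ENNReal.ofReal (bdf w ^ γ) * Φ w := by
  rw [diskMeasure, lintegral_withDensity_eq_lintegral_mul _ _ hΦ]
  · rfl
  · exact (measurable_bdf.pow_const γ).ennreal_ofReal

lemma ae_diskMeasure_iff (γ : ℝ) {P : ℂ → Prop} :
    (∀ᵐ w ∂(diskMeasure γ), P w) ↔ ∀ᵐ w ∂(volume.restrict (Metric.ball (0 : ℂ) 1)), P w := by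
  rw [diskMeasure, ae_withDensity_iff ((measurable_bdf.pow_const γ).ennreal_ofReal)]
  constructor <;> intro h
  · filter_upwards [h, ae_restrict_mem measurableSet_ball] with w hw hm
    apply hw
    have := Real.rpow_pos_of_pos (bdf_pos_iff.2 hm) γ
    simpa using this
  · filter_upwards [h] with w hw _ using hw

lemma ae_mem_ball (γ : ℝ) : ∀ᵐ w ∂(diskMeasure γ), w ∈ Metric.ball (0 : ℂ) 1 :=
  (ae_diskMeasure_iff γ).2 (ae_restrict_mem measurableSet_ball)

lemma lintegral_rayMeasure (γ : ℝ) (Ψ : (ℝ × ℝ) × ℝ → ENNReal) (hΨ : Measurable Ψ) :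
    ∫⁻ p, Ψ p ∂(rayMeasure γ) = ∫⁻ q in fanSet, ∫⁻ t in Set.Ioo 0 (2 * Real.cos q.2),
      ENNReal.ofReal (Real.cos q.2) * (ENNReal.ofReal (bdf (line q t) ^ γ) * Ψ (q, t)) := by
  have hm : Measurable fun p => (rayDensity γ p : ENNReal) :=
    (measurable_rayDensity γ).coe_nnreal_ennreal
  rw [rayMeasure, lintegral_withDensity_eq_lintegral_mul _ hm hΨ,
    lintegral_prod _ (hm.mul hΨ).aemeasurable]
  refine lintegral_congr fun q => ?_
  rw [← lintegral_indicator measurableSet_Ioo]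
  congr 1 with t
  simp only [Pi.mul_apply]
  by_cases ht : t ∈ Set.Ioo 0 (2 * Real.cos q.2)
  · have hp : (q, t) ∈ raySet := ht
    rw [Set.indicator_of_mem ht, rayDensity, Set.indicator_of_mem hp, ← mul_assoc,
      ← ENNReal.ofReal_mul (cos_pos_of_mem_raySet hp).le]
    rfl
  · have hp : (q, t) ∉ raySet := ht
    rw [Set.indicator_of_notMem ht, rayDensity, Set.indicator_of_notMem hp]
    simp

/-- Santaló's formula: following the chords transports `μ d^γ dt dα dβ` to the product of
`d^γ dx dy` with the arc length of directions. -/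
theorem measurePreserving_flow (γ : ℝ) :
    MeasurePreserving flow (rayMeasure γ) ((diskMeasure γ).prod dirMeasure) := by
  refine ⟨measurable_flow, Measure.ext_of_lintegral _ fun Ψ hΨ => ?_⟩
  have hd : Measurable fun w => ENNReal.ofReal (bdf w ^ γ) :=
    (measurable_bdf.pow_const γ).ennreal_ofReal
  rw [lintegral_map hΨ measurable_flow,
    lintegral_rayMeasure γ (fun p => Ψ (flow p)) (hΨ.comp measurable_flow),
    lintegral_prod_symm _ hΨ.aemeasurable, dirMeasure, lintegral_map _ measurable_expI]
  · rw [fanSet]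
    refine (lintegral_santalo (fun x => ENNReal.ofReal (bdf x.1 ^ γ) * Ψ x)
      ((hd.comp measurable_fst).mul hΨ)).trans ?_
    refine lintegral_congr fun θ => ?_
    exact (lintegral_diskMeasure γ (fun w => Ψ (w, Complex.exp (Complex.I * (θ : ℝ))))
      (hΨ.comp (by fun_prop))).symm
  · exact Measurable.lintegral_prod_left' hΨ

lemma ae_cos_pos : ∀ᵐ q ∂(volume.restrict fanSet), 0 < Real.cos q.2 := by
  have h : ∀ᵐ a ∂(volume.restrict (Set.Icc (-(Real.pi / 2)) (Real.pi / 2))), 0 < Real.cos a := by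
    rw [← restrict_Ioo_eq_restrict_Icc]
    filter_upwards [ae_restrict_mem measurableSet_Ioo] with a ha using Real.cos_pos_of_mem_Ioo ha
  rw [fanSet, Measure.volume_eq_prod, ← Measure.prod_restrict]
  exact Measure.quasiMeasurePreserving_snd.ae h

/-- A property that holds almost everywhere on the circle bundle holds almost everywhere along
almost every chord. -/
lemma ae_along_chords (γ : ℝ) {P : ℂ × ℂ → Prop}
    (h : ∀ᵐ x ∂((diskMeasure γ).prod dirMeasure), P x) :
    ∀ᵐ q ∂(volume.restrict fanSet), ∀ᵐ t, t ∈ Set.Ioo 0 (2 * Real.cos q.2) →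
      P (line q t, dir q) := by
  have h1 := (measurePreserving_flow γ).quasiMeasurePreserving.ae h
  rw [rayMeasure, ae_withDensity_iff (measurable_rayDensity γ).coe_nnreal_ennreal] at h1
  filter_upwards [Measure.ae_ae_of_ae_prod h1] with q hq
  filter_upwards [hq] with t ht hm
  apply ht
  have hp : (q, t) ∈ raySet := hm
  rw [rayDensity, Set.indicator_of_mem hp]
  have := mul_pos (cos_pos_of_mem_raySet hp)
    (Real.rpow_pos_of_pos (bdf_pos_of_mem_raySet hp) γ)
  simpa using this

lemma fanMeasure_absolutelyContinuous (γ : ℝ) : fanMeasure γ ≪ volume.restrict fanSet :=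
  withDensity_absolutelyContinuous _ _

lemma bundleXray_eq_integral_Ioo (γ : ℝ) (Φ : ℂ × ℂ → ℂ) {q : ℝ × ℝ} (hq : 0 < Real.cos q.2) :
    bundleXray γ Φ q = ∫ t in Set.Ioo 0 (2 * Real.cos q.2),
      Φ (line q t, dir q) * ((bdf (line q t) ^ γ : ℝ) : ℂ) := by
  rw [bundleXray, intervalIntegral.integral_of_le (by linarith), integral_Ioc_eq_integral_Ioo]

lemma bundleXray_congr (γ : ℝ) {Φ Φ' : ℂ × ℂ → ℂ}
    (h : Φ =ᵐ[(diskMeasure γ).prod dirMeasure] Φ') :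
    bundleXray γ Φ =ᵐ[volume.restrict fanSet] bundleXray γ Φ' := by
  filter_upwards [ae_along_chords γ h, ae_cos_pos] with q hq hc
  rw [bundleXray_eq_integral_Ioo _ _ hc, bundleXray_eq_integral_Ioo _ _ hc]
  refine setIntegral_congr_ae measurableSet_Ioo ?_
  filter_upwards [hq] with t ht hm
  rw [ht hm]

lemma cos_mul_bundleXray (γ : ℝ) (Φ : ℂ × ℂ → ℂ) {q : ℝ × ℝ} (hq : 0 < Real.cos q.2) :
    Real.cos q.2 * bundleXray γ Φ q = ∫ t, rayDensity γ (q, t) • Φ (flow (q, t)) := by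
  rw [bundleXray_eq_integral_Ioo _ _ hq, ← integral_const_mul,
    ← integral_indicator measurableSet_Ioo]
  congr 1 with t
  by_cases ht : t ∈ Set.Ioo 0 (2 * Real.cos q.2)
  · have hp : (q, t) ∈ raySet := ht
    rw [Set.indicator_of_mem ht, rayDensity, Set.indicator_of_mem hp, NNReal.smul_def,
      Real.coe_toNNReal _ (mul_nonneg hq.le (Real.rpow_pos_of_pos (bdf_pos_of_mem_raySet hp) γ).le),
      flow, Complex.real_smul]
    push_cast
    ring
  · have hp : (q, t) ∉ raySet := ht
    rw [Set.indicator_of_notMem ht, rayDensity, Set.indicator_of_notMem hp, zero_smul]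

lemma aestronglyMeasurable_bundleXray (γ : ℝ) {Φ : ℂ × ℂ → ℂ}
    (hΦ : AEStronglyMeasurable Φ ((diskMeasure γ).prod dirMeasure)) :
    AEStronglyMeasurable (bundleXray γ Φ) (volume.restrict fanSet) := by
  have h1 := hΦ.comp_measurePreserving (measurePreserving_flow γ)
  rw [rayMeasure, aestronglyMeasurable_withDensity_iff (measurable_rayDensity γ)] at h1
  have h2 := h1.integral_prod_right'
  -- Measurability is known for `μ` times the transform; dividing by `μ` is harmless since `μ > 0`
  -- almost everywhere.
  have h3 : AEStronglyMeasurable (fun q : ℝ × ℝ => ((Real.cos q.2)⁻¹ : ℂ))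
      (volume.restrict fanSet) := by
    refine (Measurable.aestronglyMeasurable ?_)
    fun_prop
  refine (h3.mul h2).congr ?_
  filter_upwards [ae_cos_pos] with q hq
  have hc : (Real.cos q.2 : ℂ) ≠ 0 := by exact_mod_cast hq.ne'
  have := cos_mul_bundleXray γ Φ hq
  simp only [Pi.mul_apply, Function.comp]
  rw [inv_mul_eq_iff_eq_mul₀ (by exact_mod_cast hc)]
  exact_mod_cast this.symm

lemma lintegral_beta_lt_top {γ : ℝ} (hγ : -1 < γ) :
    ∫⁻ x in Set.Ioo (0 : ℝ) 1, ENNReal.ofReal ((x * (1 - x)) ^ γ) < ⊤ := by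
  have h := Complex.betaIntegral_convergent (u := γ + 1) (v := γ + 1)
    (by simp; linarith) (by simp; linarith)
  rw [intervalIntegrable_iff_integrableOn_Ioo_of_le zero_le_one] at h
  have h2 := h.2
  rw [hasFiniteIntegral_iff_norm] at h2
  refine lt_of_le_of_lt (le_of_eq (setLIntegral_congr_fun measurableSet_Ioo fun x hx => ?_)) h2
  have h1 : 0 < 1 - x := by linarith [hx.2]
  simp only [add_sub_cancel_right]
  rw [norm_mul, Complex.norm_cpow_eq_rpow_re_of_pos hx.1, ← Complex.ofReal_one,
    ← Complex.ofReal_sub, Complex.norm_cpow_eq_rpow_re_of_pos h1, Real.mul_rpow hx.1.le h1.le]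
  simp

/-- The total weight of a chord is a multiple of `μ^{2γ+1}`. -/
lemma lintegral_chord_weight (γ : ℝ) (q : ℝ × ℝ) (hq : 0 < Real.cos q.2) :
    ∫⁻ t in Set.Ioo 0 (2 * Real.cos q.2), ENNReal.ofReal (bdf (line q t) ^ γ)
      = ENNReal.ofReal ((2 * Real.cos q.2) ^ (2 * γ + 1)) *
        ∫⁻ x in Set.Ioo (0 : ℝ) 1, ENNReal.ofReal ((x * (1 - x)) ^ γ) := by
  set c := 2 * Real.cos q.2 with hc
  have hc0 : 0 < c := by positivity
  have himg : (fun x => c * x) '' Set.Ioo 0 1 = Set.Ioo 0 c := by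
    rw [Set.image_mul_left_Ioo hc0]; simp
  rw [← himg, lintegral_image_eq_lintegral_abs_deriv_mul measurableSet_Ioo
    (f := fun x => c * x) (f' := fun _ => c * 1)
    (fun x _ => ((hasDerivAt_id x).const_mul c).hasDerivWithinAt)
    (mul_right_injective₀ hc0.ne').injOn, ← lintegral_const_mul]
  · refine setLIntegral_congr_fun measurableSet_Ioo fun x hx => ?_
    have hx1 : 0 < x * (1 - x) := mul_pos hx.1 (by linarith [hx.2])
    simp only [mul_one, bdf_line, ← hc]
    rw [abs_of_pos hc0, ← ENNReal.ofReal_mul hc0.le, ← ENNReal.ofReal_mul (by positivity)]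
    congr 1
    have : c * x * (c - c * x) = c ^ (2 : ℝ) * (x * (1 - x)) := by
      rw [Real.rpow_two]; ring
    rw [this, Real.mul_rpow (by positivity) hx1.le, ← Real.rpow_mul hc0.le,
      Real.rpow_add hc0, Real.rpow_one]
    ring
  · exact ((measurable_id.mul (measurable_const.sub measurable_id)).pow_const γ).ennreal_ofReal

/-! ### Square integrability of the transform and the pairing of data -/

lemma lintegral_mul_sq_le {μ : Measure ℝ} {W f : ℝ → ENNReal} (hW : AEMeasurable W μ)
    (hf : AEMeasurable f μ) :
    (∫⁻ t, W t * f t ∂μ) ^ (2 : ℝ) ≤ (∫⁻ t, W t ∂μ) * ∫⁻ t, W t * f t ^ (2 : ℝ) ∂μ := by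
  have h := ENNReal.lintegral_mul_le_Lp_mul_Lq μ Real.HolderConjugate.two_two
    (f := fun t => W t ^ (1 / 2 : ℝ)) (g := fun t => W t ^ (1 / 2 : ℝ) * f t)
    (hW.pow_const _) ((hW.pow_const _).mul hf)
  have e1 : ∀ x : ENNReal, x ^ (1 / 2 : ℝ) * x ^ (1 / 2 : ℝ) = x := fun x => by
    rw [← ENNReal.rpow_add_of_nonneg _ _ (by norm_num) (by norm_num)]; norm_num
  have e2 : ∀ x : ENNReal, (x ^ (1 / 2 : ℝ)) ^ (2 : ℝ) = x := fun x => by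
    rw [← ENNReal.rpow_mul]; norm_num
  simp only [Pi.mul_apply, ← mul_assoc, e1] at h
  simp only [ENNReal.mul_rpow_of_nonneg _ _ (zero_le_two : (0 : ℝ) ≤ 2), e2] at h
  calc _ ≤ _ := ENNReal.rpow_le_rpow h zero_le_two
    _ = _ := by rw [ENNReal.mul_rpow_of_nonneg _ _ zero_le_two, e2, e2]

lemma measurable_line (q : ℝ × ℝ) : Measurable (line q) := by
  unfold line; fun_prop

lemma measurable_bdf_line_rpow (γ : ℝ) (q : ℝ × ℝ) :
    Measurable fun t => ENNReal.ofReal (bdf (line q t) ^ γ) :=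
  ((measurable_bdf.comp (measurable_line q)).pow_const γ).ennreal_ofReal

/-- The constant in the `L²` bound of the X-ray transform. -/
def xrayConst (γ : ℝ) : ENNReal :=
  ENNReal.ofReal (2 ^ (2 * γ + 1)) * ∫⁻ x in Set.Ioo (0 : ℝ) 1, ENNReal.ofReal ((x * (1 - x)) ^ γ)

lemma xrayConst_lt_top {γ : ℝ} (hγ : -1 < γ) : xrayConst γ < ⊤ :=
  ENNReal.mul_lt_top ENNReal.ofReal_lt_top (lintegral_beta_lt_top hγ)

/-- The Cauchy–Schwarz inequality on one chord, for the weight `d^γ`. -/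
lemma enorm_bundleXray_sq_le (γ : ℝ) {Φ : ℂ × ℂ → ℂ} (hΦ : StronglyMeasurable Φ)
    {q : ℝ × ℝ} (hq : 0 < Real.cos q.2) :
    ENNReal.ofReal (Real.cos q.2 ^ (-2 * γ)) * ‖bundleXray γ Φ q‖ₑ ^ (2 : ℝ)
      ≤ xrayConst γ * ∫⁻ t in Set.Ioo 0 (2 * Real.cos q.2), ENNReal.ofReal (Real.cos q.2) *
        (ENNReal.ofReal (bdf (line q t) ^ γ) * ‖Φ (flow (q, t))‖ₑ ^ (2 : ℝ)) := by
  have hf : Measurable fun t => ‖Φ (flow (q, t))‖ₑ :=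
    (hΦ.measurable.comp (measurable_flow.comp measurable_prodMk_left)).enorm
  have hW := measurable_bdf_line_rpow γ q
  have h1 : ‖bundleXray γ Φ q‖ₑ ≤ ∫⁻ t in Set.Ioo 0 (2 * Real.cos q.2),
      ENNReal.ofReal (bdf (line q t) ^ γ) * ‖Φ (flow (q, t))‖ₑ := by
    rw [bundleXray_eq_integral_Ioo _ _ hq]
    refine (enorm_integral_le_lintegral_enorm _).trans (le_of_eq ?_)
    refine setLIntegral_congr_fun measurableSet_Ioo fun t ht => ?_
    have hp := Real.rpow_pos_of_pos (bdf_pos_of_mem_raySet (p := (q, t)) ht) γ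
    simp only at hp
    rw [enorm_mul, mul_comm, ← ofReal_norm ((_ : ℝ) : ℂ), Complex.norm_real,
      Real.norm_of_nonneg hp.le, flow]
  have h2 := (ENNReal.rpow_le_rpow h1 zero_le_two).trans
    (lintegral_mul_sq_le hW.aemeasurable hf.aemeasurable)
  rw [lintegral_chord_weight γ q hq] at h2
  refine (mul_le_mul_right h2 _).trans (le_of_eq ?_)
  rw [lintegral_const_mul' _ _ ENNReal.ofReal_ne_top, xrayConst]
  have h3 : ENNReal.ofReal (Real.cos q.2 ^ (-2 * γ)) *
      ENNReal.ofReal ((2 * Real.cos q.2) ^ (2 * γ + 1))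
      = ENNReal.ofReal (2 ^ (2 * γ + 1)) * ENNReal.ofReal (Real.cos q.2) := by
    rw [← ENNReal.ofReal_mul (by positivity), ← ENNReal.ofReal_mul (by positivity),
      Real.mul_rpow zero_le_two hq.le, mul_left_comm, ← Real.rpow_add hq]
    congr 2
    rw [← Real.rpow_one (Real.cos q.2), ← Real.rpow_mul hq.le]
    congr 1; ring
  rw [← mul_assoc, ← mul_assoc, h3]
  ring

lemma measurable_fan_weight (γ : ℝ) :
    Measurable fun q : ℝ × ℝ => ENNReal.ofReal (Real.cos q.2 ^ (-2 * γ)) :=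
  (Measurable.pow_const (by fun_prop) _).ennreal_ofReal

/-- The weighted X-ray transform is bounded from `L²(d^γ)` to `L²(μ^{-2γ} dβ dα)`: this is the
Cauchy–Schwarz inequality on every chord, followed by Santaló's formula. -/
theorem memLp_bundleXray {γ : ℝ} (hγ : -1 < γ) {Φ : ℂ × ℂ → ℂ}
    (hΦ : MemLp Φ 2 ((diskMeasure γ).prod dirMeasure)) :
    MemLp (bundleXray γ Φ) 2 (fanMeasure γ) := by
  obtain ⟨Φ', hm, hae⟩ := hΦ.1
  have hΦ' : MemLp Φ' 2 ((diskMeasure γ).prod dirMeasure) := hΦ.ae_eq hae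
  have hXae : bundleXray γ Φ' =ᵐ[fanMeasure γ] bundleXray γ Φ :=
    (fanMeasure_absolutelyContinuous γ).ae_eq (bundleXray_congr γ hae.symm)
  refine MemLp.ae_eq hXae ?_
  have hXm := aestronglyMeasurable_bundleXray γ hm.aestronglyMeasurable
  refine ⟨hXm.mono_ac (fanMeasure_absolutelyContinuous γ), ?_⟩
  rw [eLpNorm_lt_top_iff_lintegral_rpow_enorm_lt_top two_ne_zero ENNReal.ofNat_ne_top]
  have hfin := (eLpNorm_lt_top_iff_lintegral_rpow_enorm_lt_top two_ne_zero
    ENNReal.ofNat_ne_top).1 hΦ'.2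
  simp only [ENNReal.toReal_ofNat] at hfin ⊢
  have hΦm : Measurable fun x => ‖Φ' x‖ₑ ^ (2 : ℝ) := hm.measurable.enorm.pow_const _
  rw [← (measurePreserving_flow γ).lintegral_comp hΦm,
    lintegral_rayMeasure γ (fun p => ‖Φ' (flow p)‖ₑ ^ (2 : ℝ)) (hΦm.comp measurable_flow)] at hfin
  rw [fanMeasure, lintegral_withDensity_eq_lintegral_mul₀' (measurable_fan_weight γ).aemeasurable
    ((hXm.mono_ac (fanMeasure_absolutelyContinuous γ)).enorm.pow_const _)]
  refine lt_of_le_of_lt ?_ (ENNReal.mul_lt_top (xrayConst_lt_top hγ) hfin)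
  rw [← lintegral_const_mul' _ _ (xrayConst_lt_top hγ).ne]
  refine lintegral_mono_ae ?_
  filter_upwards [ae_cos_pos] with q hq
  exact enorm_bundleXray_sq_le γ hm hq

lemma dirMeasure_univ : dirMeasure Set.univ = ENNReal.ofReal (2 * Real.pi) := by
  rw [dirMeasure, Measure.map_apply measurable_expI MeasurableSet.univ]
  simp

lemma isFiniteMeasure_diskMeasure {γ : ℝ} (hγ : -1 < γ) : IsFiniteMeasure (diskMeasure γ) := by
  have h := (measurePreserving_flow γ).lintegral_comp (f := fun _ => (1 : ENNReal))
    measurable_const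
  rw [lintegral_rayMeasure γ (fun _ => 1) measurable_const, lintegral_const, one_mul,
    ← Set.univ_prod_univ, Measure.prod_prod, dirMeasure_univ] at h
  have hlt : diskMeasure γ Set.univ * ENNReal.ofReal (2 * Real.pi) < ⊤ := by
    rw [← h]
    have hvol : volume fanSet < ⊤ := by
      rw [fanSet, Measure.volume_eq_prod, Measure.prod_prod]
      simp [ENNReal.mul_lt_top_iff]
    refine lt_of_le_of_lt (b := ∫⁻ _ in fanSet, xrayConst γ) ?_ ?_
    · refine lintegral_mono_ae ?_
      filter_upwards [ae_cos_pos] with q hq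
      simp only [mul_one]
      rw [lintegral_const_mul _ (measurable_bdf_line_rpow γ q), lintegral_chord_weight γ q hq,
        xrayConst, ← mul_assoc]
      gcongr
      rw [← ENNReal.ofReal_mul hq.le]
      apply ENNReal.ofReal_le_ofReal
      rw [Real.mul_rpow zero_le_two hq.le, mul_left_comm]
      have e : Real.cos q.2 * Real.cos q.2 ^ (2 * γ + 1) = Real.cos q.2 ^ (2 * γ + 2) := by
        rw [show 2 * γ + 2 = 1 + (2 * γ + 1) by ring, Real.rpow_add hq 1, Real.rpow_one]
      rw [e]
      have := Real.rpow_le_one hq.le (Real.cos_le_one q.2) (by linarith : 0 ≤ 2 * γ + 2)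
      have h2 : 0 < (2 : ℝ) ^ (2 * γ + 1) := by positivity
      nlinarith
    · rw [lintegral_const, Measure.restrict_apply_univ]
      exact ENNReal.mul_lt_top (xrayConst_lt_top hγ) hvol
  refine ⟨?_⟩
  rcases ENNReal.mul_lt_top_iff.1 hlt with h | h | h
  · exact h.1
  · rw [h]; exact ENNReal.zero_lt_top
  · exfalso
    rw [ENNReal.ofReal_eq_zero] at h
    linarith [Real.pi_pos]

/-- Santaló's formula for integrable functions. -/
lemma integral_eq_integral_fan (γ : ℝ) {L : ℂ × ℂ → ℂ}
    (hint : Integrable L ((diskMeasure γ).prod dirMeasure)) :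
    ∫ x, L x ∂((diskMeasure γ).prod dirMeasure)
      = ∫ q in fanSet, Real.cos q.2 * bundleXray γ L q := by
  have hcomp : Integrable (fun p => L (flow p)) (rayMeasure γ) :=
    (measurePreserving_flow γ).integrable_comp_of_integrable hint
  rw [rayMeasure, integrable_withDensity_iff_integrable_smul (measurable_rayDensity γ)] at hcomp
  have hmap : AEStronglyMeasurable L ((rayMeasure γ).map flow) := by
    rw [(measurePreserving_flow γ).map_eq]; exact hint.1
  rw [← (measurePreserving_flow γ).map_eq, integral_map measurable_flow.aemeasurable hmap,
    rayMeasure, integral_withDensity_eq_integral_smul (measurable_rayDensity γ),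
    integral_prod _ hcomp]
  refine integral_congr_ae ?_
  filter_upwards [ae_cos_pos] with q hq
  rw [← cos_mul_bundleXray γ L hq]

lemma fanPairing_eq (γ : ℝ) (u v : ℝ × ℝ → ℂ) :
    fanPairing γ u v = ∫ q in fanSet, (Real.cos q.2 ^ (-2 * γ) : ℝ) • (u q * conj (v q)) := by
  rw [fanPairing, fanMeasure,
    integral_withDensity_eq_integral_toReal_smul (measurable_fan_weight γ)
      (ae_of_all _ fun _ => ENNReal.ofReal_lt_top)]
  refine integral_congr_ae ?_
  filter_upwards [ae_cos_pos] with q hq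
  rw [ENNReal.toReal_ofReal (by positivity)]

/-- Pairing a transform with `μ^{2γ+1} K`, where `K` is constant along the chords, is a pairing
on the circle bundle. -/
theorem fanPairing_bundleXray {γ : ℝ} {Φ K : ℂ × ℂ → ℂ} {k : ℝ × ℝ → ℂ}
    (hint : Integrable (fun x => Φ x * conj (K x)) ((diskMeasure γ).prod dirMeasure))
    (hk : ∀ q : ℝ × ℝ, ∀ t ∈ Set.Ioo 0 (2 * Real.cos q.2),
      k q = ((Real.cos q.2 ^ (2 * γ + 1) : ℝ) : ℂ) * K (line q t, dir q)) :
    fanPairing γ (bundleXray γ Φ) k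
      = ∫ x, Φ x * conj (K x) ∂((diskMeasure γ).prod dirMeasure) := by
  rw [integral_eq_integral_fan γ hint, fanPairing_eq]
  refine integral_congr_ae ?_
  filter_upwards [ae_cos_pos] with q hq
  -- The constant value of `K` on the chord is read off at its midpoint.
  have hmid : Real.cos q.2 ∈ Set.Ioo 0 (2 * Real.cos q.2) := ⟨hq, by linarith⟩
  obtain ⟨κ, hκ⟩ : ∃ κ, κ = K (line q (Real.cos q.2), dir q) := ⟨_, rfl⟩
  have hconst : ∀ t ∈ Set.Ioo 0 (2 * Real.cos q.2), K (line q t, dir q) = κ := fun t ht => by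
    have h1 := (hk q t ht).symm.trans (hk q _ hmid)
    have h2 : ((Real.cos q.2 ^ (2 * γ + 1) : ℝ) : ℂ) ≠ 0 := by
      exact_mod_cast (Real.rpow_pos_of_pos hq _).ne'
    rw [hκ]
    exact mul_left_cancel₀ h2 h1
  have hX : bundleXray γ (fun x => Φ x * conj (K x)) q = bundleXray γ Φ q * conj κ := by
    rw [bundleXray_eq_integral_Ioo _ _ hq, bundleXray_eq_integral_Ioo _ _ hq,
      ← integral_mul_const]
    refine setIntegral_congr_fun measurableSet_Ioo fun t ht => ?_
    rw [hconst t ht]; ring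
  rw [hX, hk q _ hmid, ← hκ, map_mul, Complex.conj_ofReal, Complex.real_smul]
  have h3 : ((Real.cos q.2 ^ (-2 * γ) : ℝ) : ℂ) * ((Real.cos q.2 ^ (2 * γ + 1) : ℝ) : ℂ)
      = (Real.cos q.2 : ℂ) := by
    rw [← Complex.ofReal_mul, ← Real.rpow_add hq]
    congr 1
    rw [← Real.rpow_one (Real.cos q.2), ← Real.rpow_mul hq.le]
    congr 1; ring
  linear_combination (bundleXray γ Φ q * conj κ) * h3

/-! ### The reconstruction kernel on the circle bundle -/

/-- The base of the power in the reconstruction kernel, at the point `w` and the direction `v`;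
along a line it equals the product over the two endpoints `e` of the factors `1 - e z̄`. -/
def kernelBase (z w v : ℂ) : ℂ := 1 - w * conj z + v ^ 2 * conj z * (conj w - conj z)

/-- The reconstruction kernel without its factors `μ^{2γ+1}` and `v^{2j}`, as a function of a
point and a direction. -/
def bundleKernel (γ : ℝ) (z : ℂ) (x : ℂ × ℂ) : ℂ :=
  ((γ : ℂ) + 1) / (2 * (Real.pi : ℂ) ^ 2) * (1 + x.2 ^ 2 * conj z ^ 2)
    / kernelBase z x.1 x.2 ^ ((γ : ℂ) + 2)

lemma norm_dir (q : ℝ × ℝ) : ‖dir q‖ = 1 := norm_expI _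

lemma conj_expI (a : ℝ) : conj (Complex.exp (Complex.I * a)) = Complex.exp (Complex.I * (-a : ℝ)) := by
  rw [← Complex.exp_conj, map_mul, Complex.conj_I, Complex.conj_ofReal]
  push_cast; ring_nf

lemma kernelBase_line (z : ℂ) (q : ℝ × ℝ) (t : ℝ) :
    (1 - Complex.exp (Complex.I * q.1) * conj z)
        * (1 - Complex.exp (Complex.I * (q.1 + 2 * q.2 + Real.pi)) * conj z)
      = kernelBase z (line q t) (dir q) := by
  have hv : dir q * conj (dir q) = 1 := by
    rw [Complex.mul_conj, Complex.normSq_eq_norm_sq, norm_dir]; simp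
  obtain ⟨E, hE⟩ : ∃ E, E = Complex.exp (Complex.I * ((-q.2 : ℝ) : ℂ)) := ⟨_, rfl⟩
  have hEE : E * conj E = 1 := by
    rw [Complex.mul_conj, Complex.normSq_eq_norm_sq, hE, norm_expI]; simp
  have h1 : Complex.exp (Complex.I * q.1) = - (dir q * E) := by
    have := line_eq q 0
    rw [line] at this
    rw [hE]
    simpa using this
  have h2 : Complex.exp (Complex.I * (q.1 + 2 * q.2 + Real.pi)) = dir q * conj E := by
    rw [hE, conj_expI, dir, ← Complex.exp_add, angle]
    congr 1; push_cast; ring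
  rw [h1, h2, kernelBase, line_eq, ← hE, map_mul, map_sub, Complex.conj_ofReal]
  linear_combination (-(dir q) ^ 2 * (conj z) ^ 2) * hEE -
    (dir q * conj z * (t - conj E)) * hv

/-- Up to the factor `μ^{2γ+1}`, the kernel of the theorem is the restriction to the chords of a
function on the circle bundle, which is therefore constant along each chord. -/
lemma kernel_eq (γ : ℝ) (j : ℕ) (z : ℂ) (q : ℝ × ℝ) (t : ℝ) :
    kernel γ j z q = ((Real.cos q.2 ^ (2 * γ + 1) : ℝ) : ℂ) *
      (dir q ^ (2 * j) * bundleKernel γ z (line q t, dir q)) := by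
  have h1 : Complex.exp (2 * j * Complex.I * angle q) = dir q ^ (2 * j) := by
    rw [dir, ← Complex.exp_nat_mul]; congr 1; push_cast; ring
  have h2 : Complex.exp (Complex.I * (2 * q.1 + 2 * q.2)) = dir q ^ 2 := by
    rw [dir, ← Complex.exp_nat_mul, angle]
    have : ((2 : ℕ) : ℂ) * (Complex.I * ((q.1 + q.2 + Real.pi : ℝ) : ℂ))
        = Complex.I * (2 * q.1 + 2 * q.2) + 2 * Real.pi * Complex.I := by push_cast; ring
    rw [this, Complex.exp_add, Complex.exp_two_pi_mul_I, mul_one]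
  rw [kernel, kernelBase_line z q t, h1, h2, bundleKernel]
  simp only [div_eq_mul_inv]
  ring

lemma kernelOdd_eq (γ : ℝ) (j : ℕ) (z : ℂ) (q : ℝ × ℝ) (t : ℝ) :
    kernelOdd γ j z q = ((Real.cos q.2 ^ (2 * γ + 1) : ℝ) : ℂ) *
      (dir q ^ (2 * j + 1) * bundleKernel γ z (line q t, dir q)) := by
  rw [kernelOdd, kernel_eq γ j z q t, ← dir]; ring

lemma norm_sub_le_norm_one_sub_mul_conj {z w : ℂ} (hz : ‖z‖ ≤ 1) (hw : ‖w‖ ≤ 1) :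
    ‖w - z‖ ≤ ‖1 - w * conj z‖ := by
  rw [← sq_le_sq₀ (norm_nonneg _) (norm_nonneg _), ← Complex.normSq_eq_norm_sq,
    ← Complex.normSq_eq_norm_sq]
  have h1 : Complex.normSq z ≤ 1 := by
    rw [Complex.normSq_eq_norm_sq]; nlinarith [norm_nonneg z]
  have h2 : Complex.normSq w ≤ 1 := by
    rw [Complex.normSq_eq_norm_sq]; nlinarith [norm_nonneg w]
  simp only [Complex.normSq_apply] at *
  simp
  nlinarith [mul_nonneg (sub_nonneg.2 h1) (sub_nonneg.2 h2)]

lemma one_sub_norm_le_norm {z w : ℂ} (hw : ‖w‖ ≤ 1) : 1 - ‖z‖ ≤ ‖1 - w * conj z‖ := by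
  have h := norm_sub_norm_le (1 : ℂ) (w * conj z)
  rw [norm_one, norm_mul, Complex.norm_conj] at h
  nlinarith [norm_nonneg z]

lemma one_sub_norm_le_re {z w : ℂ} (hw : ‖w‖ ≤ 1) : 1 - ‖z‖ ≤ (1 - w * conj z).re := by
  have h := (Complex.abs_re_le_norm (w * conj z))
  rw [norm_mul, Complex.norm_conj] at h
  have := (abs_le.1 h).2
  simp only [Complex.sub_re, Complex.one_re]
  nlinarith [norm_nonneg z]

/-- The base of the kernel is a product of two numbers of positive real part, also for directions
`v` inside the unit circle. -/
lemma kernelBase_eq_mul {z w v : ℂ} (hz : ‖z‖ < 1) (hw : ‖w‖ ≤ 1) (hv : ‖v‖ ≤ 1) :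
    ∃ ε : ℂ, ‖ε‖ ≤ ‖z‖ ∧ kernelBase z w v = (1 - w * conj z) * (1 + ε) := by
  have hpos : 0 < ‖1 - w * conj z‖ := lt_of_lt_of_le (by linarith) (one_sub_norm_le_norm hw)
  refine ⟨v ^ 2 * conj z * (conj w - conj z) / (1 - w * conj z), ?_, ?_⟩
  · rw [norm_div, div_le_iff₀ hpos, norm_mul, norm_mul, norm_pow, ← map_sub, Complex.norm_conj,
      Complex.norm_conj]
    have h1 := norm_sub_le_norm_one_sub_mul_conj hz.le hw
    have h2 : ‖v‖ ^ 2 ≤ 1 := pow_le_one₀ (norm_nonneg _) hv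
    calc ‖v‖ ^ 2 * ‖z‖ * ‖w - z‖ ≤ 1 * ‖z‖ * ‖1 - w * conj z‖ := by gcongr
      _ = _ := by ring
  · rw [kernelBase, mul_add, mul_one, mul_div_cancel₀]
    exact norm_pos_iff.1 hpos

lemma mul_mem_slitPlane_of_re_pos {a b : ℂ} (ha : 0 < a.re) (hb : 0 < b.re) :
    a * b ∈ Complex.slitPlane := by
  rw [Complex.mem_slitPlane_iff, Complex.mul_re, Complex.mul_im]
  by_contra h
  push Not at h
  obtain ⟨h1, h2⟩ := h
  have : a.im * a.re * b.re = - (a.re ^ 2) * b.im := by linear_combination a.re * h2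
  have h3 : b.im * a.re = - (a.im * b.re) := by linarith
  have h4 : 0 ≤ a.im ^ 2 := sq_nonneg _
  have h5 : a.re * (a.re * b.re - a.im * b.im) = b.re * (a.re ^ 2 + a.im ^ 2) := by
    linear_combination (-a.im) * h3
  have h6 : 0 < b.re * (a.re ^ 2 + a.im ^ 2) := by positivity
  nlinarith

lemma kernelBase_mem_slitPlane {z w v : ℂ} (hz : ‖z‖ < 1) (hw : ‖w‖ ≤ 1) (hv : ‖v‖ ≤ 1) :
    kernelBase z w v ∈ Complex.slitPlane := by
  obtain ⟨ε, hε, h⟩ := kernelBase_eq_mul hz hw hv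
  rw [h]
  refine mul_mem_slitPlane_of_re_pos (lt_of_lt_of_le (by linarith) (one_sub_norm_le_re hw)) ?_
  have := (abs_le.1 (Complex.abs_re_le_norm ε)).1
  simp only [Complex.add_re, Complex.one_re]
  linarith

lemma sq_le_norm_kernelBase {z w v : ℂ} (hz : ‖z‖ < 1) (hw : ‖w‖ ≤ 1) (hv : ‖v‖ ≤ 1) :
    (1 - ‖z‖) ^ 2 ≤ ‖kernelBase z w v‖ := by
  obtain ⟨ε, hε, h⟩ := kernelBase_eq_mul hz hw hv
  rw [h, norm_mul, sq]
  have h1 : 1 - ‖z‖ ≤ ‖1 + ε‖ := by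
    have := norm_sub_norm_le (1 : ℂ) (-ε)
    rw [norm_one, norm_neg, sub_neg_eq_add] at this
    linarith
  exact mul_le_mul (one_sub_norm_le_norm hw) h1 (by linarith) (norm_nonneg _)

/-- A bound for the reconstruction kernel on the circle bundle. -/
def kernelBound (γ : ℝ) (z : ℂ) : ℝ :=
  (γ + 1) / Real.pi ^ 2 / ((1 - ‖z‖) ^ 2) ^ (γ + 2)

lemma norm_bundleKernel_le {γ : ℝ} (hγ : -1 < γ) {z w v : ℂ} (hz : ‖z‖ < 1) (hw : ‖w‖ ≤ 1)
    (hv : ‖v‖ ≤ 1) : ‖bundleKernel γ z (w, v)‖ ≤ kernelBound γ z := by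
  have hb := sq_le_norm_kernelBase hz hw hv
  have hb0 : 0 < (1 - ‖z‖) ^ 2 := by have : 0 < 1 - ‖z‖ := by linarith
                                     positivity
  have hne : kernelBase z w v ≠ 0 := norm_pos_iff.1 (hb0.trans_le hb)
  have h1 : ‖kernelBase z w v ^ ((γ : ℂ) + 2)‖ = ‖kernelBase z w v‖ ^ (γ + 2) := by
    rw [Complex.norm_cpow_of_ne_zero hne]; simp
  have h2 : ‖((γ : ℂ) + 1) / (2 * (Real.pi : ℂ) ^ 2) * (1 + v ^ 2 * conj z ^ 2)‖
      ≤ (γ + 1) / Real.pi ^ 2 := by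
    have e : ((γ : ℂ) + 1) / (2 * (Real.pi : ℂ) ^ 2)
        = (((γ + 1) / (2 * Real.pi ^ 2) : ℝ) : ℂ) := by push_cast; rfl
    rw [norm_mul, e, Complex.norm_real, Real.norm_of_nonneg
      (div_nonneg (by linarith) (by positivity))]
    have h3 : ‖1 + v ^ 2 * conj z ^ 2‖ ≤ 2 := by
      refine (norm_add_le _ _).trans ?_
      rw [norm_one, norm_mul, norm_pow, norm_pow, Complex.norm_conj]
      have := mul_le_one₀ (pow_le_one₀ (norm_nonneg v) hv (n := 2)) (by positivity)
        (pow_le_one₀ (norm_nonneg z) hz.le (n := 2))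
      linarith
    calc _ ≤ (γ + 1) / (2 * Real.pi ^ 2) * 2 :=
          mul_le_mul_of_nonneg_left h3 (div_nonneg (by linarith) (by positivity))
      _ = _ := by field_simp
  rw [bundleKernel, norm_div, h1, kernelBound]
  have h4 : 0 < ((1 - ‖z‖) ^ 2) ^ (γ + 2) := Real.rpow_pos_of_pos hb0 _
  exact div_le_div₀ (div_nonneg (by linarith) (by positivity)) h2 h4
    (Real.rpow_le_rpow hb0.le hb (by linarith))

lemma measurable_bundleKernel (γ : ℝ) (z : ℂ) : Measurable (bundleKernel γ z) := by
  unfold bundleKernel kernelBase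
  have : Measurable fun x : ℂ × ℂ => conj x.1 := Complex.continuous_conj.measurable.comp measurable_fst
  fun_prop

/-- Functions of the form `μ^{2γ+1} K` with `K` bounded on the chords are square integrable. -/
lemma memLp_fan_of_eq_mul {γ : ℝ} (hγ : -1 < γ) {k : ℝ × ℝ → ℂ} (hkm : Measurable k) {C : ℝ}
    (hk : ∀ q : ℝ × ℝ, 0 < Real.cos q.2 → ‖k q‖ ≤ Real.cos q.2 ^ (2 * γ + 1) * C) :
    MemLp k 2 (fanMeasure γ) := by
  refine ⟨hkm.aestronglyMeasurable, ?_⟩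
  rw [eLpNorm_lt_top_iff_lintegral_rpow_enorm_lt_top two_ne_zero ENNReal.ofNat_ne_top]
  simp only [ENNReal.toReal_ofNat]
  rw [fanMeasure, lintegral_withDensity_eq_lintegral_mul _ (measurable_fan_weight γ)
    (hkm.enorm.pow_const _)]
  have hvol : volume fanSet < ⊤ := by
    rw [fanSet, Measure.volume_eq_prod, Measure.prod_prod]
    simp [ENNReal.mul_lt_top_iff]
  refine lt_of_le_of_lt (b := ∫⁻ _ in fanSet, ENNReal.ofReal (C ^ 2)) ?_ ?_
  · refine lintegral_mono_ae ?_
    filter_upwards [ae_cos_pos] with q hq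
    rw [Pi.mul_apply, ← ofReal_norm, ENNReal.ofReal_rpow_of_nonneg (norm_nonneg _) zero_le_two,
      ← ENNReal.ofReal_mul (by positivity), Real.rpow_two]
    apply ENNReal.ofReal_le_ofReal
    have h1 : ‖k q‖ ^ 2 ≤ (Real.cos q.2 ^ (2 * γ + 1) * C) ^ 2 :=
      pow_le_pow_left₀ (norm_nonneg _) (hk q hq) 2
    have h2 : Real.cos q.2 ^ (-2 * γ) * (Real.cos q.2 ^ (2 * γ + 1)) ^ 2
        = Real.cos q.2 ^ (2 * γ + 2) := by
      rw [← Real.rpow_natCast, ← Real.rpow_mul hq.le, ← Real.rpow_add hq]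
      congr 1; push_cast; ring
    have h3 := Real.rpow_le_one hq.le (Real.cos_le_one q.2) (by linarith : 0 ≤ 2 * γ + 2)
    calc Real.cos q.2 ^ (-2 * γ) * ‖k q‖ ^ 2
        ≤ Real.cos q.2 ^ (-2 * γ) * (Real.cos q.2 ^ (2 * γ + 1) * C) ^ 2 := by gcongr
      _ = Real.cos q.2 ^ (2 * γ + 2) * C ^ 2 := by rw [mul_pow, ← mul_assoc, h2]
      _ ≤ 1 * C ^ 2 := by gcongr
      _ = C ^ 2 := one_mul _
  · rw [lintegral_const, Measure.restrict_apply_univ]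
    exact ENNReal.mul_lt_top ENNReal.ofReal_lt_top hvol

lemma norm_line_lt_one {q : ℝ × ℝ} (hq : 0 < Real.cos q.2) : ‖line q (Real.cos q.2)‖ < 1 := by
  have : 0 < bdf (line q (Real.cos q.2)) :=
    bdf_pos_of_mem_raySet (p := (q, Real.cos q.2)) ⟨hq, by simp only; linarith⟩
  rw [bdf_pos_iff, mem_ball_zero_iff] at this
  exact this

lemma measurable_dir_pow_mul_bundleKernel (γ : ℝ) (n : ℕ) (z : ℂ) :
    Measurable fun q : ℝ × ℝ => ((Real.cos q.2 ^ (2 * γ + 1) : ℝ) : ℂ) *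
      (dir q ^ n * bundleKernel γ z (line q 0, dir q)) := by
  have h0 : Measurable fun q : ℝ × ℝ => (line q 0, dir q) :=
    measurable_flow.comp (measurable_id.prodMk measurable_const)
  refine Measurable.mul ?_ (((measurable_snd.comp h0).pow_const n).mul
    ((measurable_bundleKernel γ z).comp h0))
  exact Complex.measurable_ofReal.comp (Measurable.pow_const (by fun_prop) _)

lemma memLp_of_eq_bundleKernel {γ : ℝ} (hγ : -1 < γ) (n : ℕ) {z : ℂ} (hz : ‖z‖ < 1)
    {k : ℝ × ℝ → ℂ} (hk : ∀ q t, k q = ((Real.cos q.2 ^ (2 * γ + 1) : ℝ) : ℂ) *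
      (dir q ^ n * bundleKernel γ z (line q t, dir q))) :
    MemLp k 2 (fanMeasure γ) := by
  refine memLp_fan_of_eq_mul (C := kernelBound γ z) hγ ?_ fun q hq => ?_
  · have : k = fun q => _ := funext fun q => hk q 0
    rw [this]
    exact measurable_dir_pow_mul_bundleKernel γ n z
  · rw [hk q (Real.cos q.2), norm_mul, Complex.norm_real, Real.norm_of_nonneg (by positivity),
      norm_mul, norm_pow, norm_dir, one_pow, one_mul]
    have := norm_bundleKernel_le hγ hz (norm_line_lt_one hq).le (norm_dir q).le
    gcongr

/-! ### The Cauchy–Pompeiu formula -/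

/-- The coefficient of `dw̄` in a real-linear form `L = a dw + b dw̄`. -/
def dbar (L : ℂ →L[ℝ] ℂ) : ℂ := (L 1 + Complex.I * L Complex.I) / 2

lemma dbar_eq_of_unit (L : ℂ →L[ℝ] ℂ) {e : ℂ} (he : ‖e‖ = 1) :
    dbar L / e = (L e + Complex.I * L (Complex.I * e)) / 2 := by
  have h1 : ∀ w : ℂ, L w = w.re * L 1 + w.im * L Complex.I := fun w => by
    have : w = w.re • (1 : ℂ) + w.im • Complex.I := by
      apply Complex.ext <;> simp
    conv_lhs => rw [this]
    rw [map_add, map_smul, map_smul, Complex.real_smul, Complex.real_smul]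
  have hne : e ≠ 0 := norm_pos_iff.1 (by rw [he]; exact one_pos)
  have hc : conj e * e = 1 := by
    rw [mul_comm, Complex.mul_conj, Complex.normSq_eq_norm_sq, he]; simp
  have h2 : (e.re : ℂ) - e.im * Complex.I = conj e := by
    apply Complex.ext <;> simp
  rw [div_eq_iff hne, h1 e, h1 (Complex.I * e), dbar]
  simp only [Complex.mul_re, Complex.mul_im, Complex.I_re, Complex.I_im, zero_mul, one_mul,
    zero_sub, zero_add]
  push_cast
  have h3 : (L 1 + Complex.I * L Complex.I) * (conj e * e) = L 1 + Complex.I * L Complex.I := by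
    rw [hc, mul_one]
  rw [← h2] at h3
  linear_combination (-1 / 2) * h3 - (e.im * L Complex.I * e / 2) * Complex.I_sq

lemma integrableOn_polar {f : ℝ × ℝ → ℂ} (hf : Continuous f) {R : ℝ}
    (hR : ∀ p : ℝ × ℝ, R < p.1 → f p = 0) :
    IntegrableOn f (Set.Ioi (0 : ℝ) ×ˢ Set.Ioo (-Real.pi) Real.pi) (volume.prod volume) := by
  have h1 : IntegrableOn f (Set.Icc 0 R ×ˢ Set.Icc (-Real.pi) Real.pi) (volume.prod volume) :=
    hf.continuousOn.integrableOn_compact (isCompact_Icc.prod isCompact_Icc)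
  refine h1.of_forall_sdiff_eq_zero (measurableSet_Ioi.prod measurableSet_Ioo) ?_
  rintro ⟨r, θ⟩ ⟨⟨hr, hθ⟩, h2⟩
  refine hR _ ?_
  by_contra hle
  push Not at hle
  exact h2 ⟨⟨le_of_lt hr, hle⟩, Set.Ioo_subset_Icc_self hθ⟩

/-- The Cauchy–Pompeiu formula at the origin, for compactly supported functions. In polar coordinates the
integrand is `(∂_r φ + (i / r) ∂_θ φ) / 2`, and the second term has mean zero on
circles. -/
lemma integral_dbar_div_zero {φ : ℂ → ℂ} (hφ : ContDiff ℝ 1 φ) (hc : HasCompactSupport φ) :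
    ∫ w, dbar (fderiv ℝ φ w) / w = -(Real.pi * φ 0) := by
  set e : ℝ → ℂ := fun θ => Complex.exp (Complex.I * θ) with he
  have he1 : ∀ θ, ‖e θ‖ = 1 := norm_expI
  have hecont : Continuous e := by fun_prop
  have hd : Continuous (fderiv ℝ φ) := hφ.continuous_fderiv one_ne_zero
  have hφd : Differentiable ℝ φ := hφ.differentiable one_ne_zero
  obtain ⟨R, hR⟩ : ∃ R, ∀ w : ℂ, R < ‖w‖ → φ w = 0 ∧ fderiv ℝ φ w = 0 := by
    obtain ⟨R, hR⟩ := hc.isCompact.isBounded.subset_closedBall 0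
    refine ⟨R, fun w hw => ?_⟩
    have hw' : w ∉ tsupport φ := fun h => by
      have := hR h; rw [mem_closedBall_zero_iff] at this; linarith
    exact ⟨image_eq_zero_of_notMem_tsupport hw',
      image_eq_zero_of_notMem_tsupport fun h => hw' (tsupport_fderiv_subset ℝ h)⟩
  set F1 : ℝ × ℝ → ℂ := fun p => fderiv ℝ φ (p.1 * e p.2) (e p.2) with hF1
  set F2 : ℝ × ℝ → ℂ := fun p => fderiv ℝ φ (p.1 * e p.2) (Complex.I * e p.2) with hF2
  have hc0 : Continuous fun p : ℝ × ℝ => fderiv ℝ φ (p.1 * e p.2) := hd.comp (by fun_prop)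
  have hF1c : Continuous F1 := hc0.clm_apply (by fun_prop)
  have hF2c : Continuous F2 := hc0.clm_apply (by fun_prop)
  have hnorm : ∀ p : ℝ × ℝ, ‖(p.1 : ℂ) * e p.2‖ = |p.1| := fun p => by
    rw [norm_mul, he1, mul_one, Complex.norm_real, Real.norm_eq_abs]
  have hz : ∀ p : ℝ × ℝ, R < p.1 → fderiv ℝ φ (p.1 * e p.2) = 0 := fun p hp =>
    (hR _ (by rw [hnorm]; exact hp.trans_le (le_abs_self _))).2
  have hI1 := integrableOn_polar hF1c (R := R) fun p hp => by simp [hF1, hz p hp]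
  have hI2 := integrableOn_polar hF2c (R := R) fun p hp => by simp [hF2, hz p hp]
  rw [← Complex.integral_comp_polarCoord_symm, polarCoord_target]
  have hcongr : ∀ p ∈ Set.Ioi (0 : ℝ) ×ˢ Set.Ioo (-Real.pi) Real.pi,
      p.1 • (dbar (fderiv ℝ φ (Complex.polarCoord.symm p)) / (Complex.polarCoord.symm p))
        = 1 / 2 * F1 p + Complex.I / 2 * F2 p := by
    intro p hp
    have hp1 : (p.1 : ℂ) ≠ 0 := by exact_mod_cast (ne_of_gt hp.1)
    have h1 : Complex.polarCoord.symm p = p.1 * e p.2 := by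
      rw [Complex.polarCoord_symm_apply]
      simp only [he]
      rw [mul_comm Complex.I, Complex.exp_mul_I]
      push_cast; rfl
    rw [h1, Complex.real_smul, mul_comm (p.1 : ℂ) (e p.2), ← div_div, mul_div_cancel₀ _ hp1,
      mul_comm (e p.2), dbar_eq_of_unit _ (he1 p.2)]
    simp only [hF1, hF2]
    ring
  rw [setIntegral_congr_fun (measurableSet_Ioi.prod measurableSet_Ioo) hcongr,
    Measure.volume_eq_prod,
    integral_add (hI1.const_mul _) (hI2.const_mul _), integral_const_mul, integral_const_mul]
  have hr : ∀ (θ r : ℝ), HasDerivAt (fun r : ℝ => φ (r * e θ)) (F1 (r, θ)) r := fun θ r => by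
    have h1 : HasDerivAt (fun r : ℝ => (r : ℂ) * e θ) (e θ) r := by
      simpa using (Complex.ofRealCLM.hasDerivAt (x := r)).mul_const (e θ)
    exact (hφd _).hasFDerivAt.comp_hasDerivAt r h1
  have hθ : ∀ (r θ : ℝ), HasDerivAt (fun θ : ℝ => φ (r * e θ)) (r * F2 (r, θ)) θ := fun r θ => by
    have h0 : HasDerivAt e (Complex.I * e θ) θ := by
      have h3 : HasDerivAt (fun θ : ℝ => Complex.I * (θ : ℂ)) (Complex.I * 1) θ :=
        (Complex.ofRealCLM.hasDerivAt (x := θ)).const_mul Complex.I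
      have := h3.cexp
      simpa [he, mul_comm] using this
    have h1 := h0.const_mul (r : ℂ)
    have h2 := (hφd (r * e θ)).hasFDerivAt.comp_hasDerivAt θ h1
    have h4 : (r : ℂ) * (Complex.I * e θ) = r • (Complex.I * e θ) := (Complex.real_smul).symm
    rw [h4, map_smul, Complex.real_smul] at h2
    exact h2
  -- On each ray the radial derivative integrates to `-φ 0`.
  have hint1 : ∫ p in Set.Ioi (0 : ℝ) ×ˢ Set.Ioo (-Real.pi) Real.pi, F1 p ∂(volume.prod volume)
      = -(2 * Real.pi * φ 0) := by
    rw [← setIntegral_prod_swap, setIntegral_prod (fun z : ℝ × ℝ => F1 z.swap) hI1.swap]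
    have : ∀ θ : ℝ, ∫ r in Set.Ioi (0 : ℝ), F1 (r, θ) = - φ 0 := fun θ => by
      have h1 : ContDiff ℝ 1 fun r : ℝ => φ (r * e θ) :=
        hφ.comp ((Complex.ofRealCLM.contDiff).mul contDiff_const)
      have h2 : HasCompactSupport fun r : ℝ => φ (r * e θ) := by
        refine HasCompactSupport.intro (isCompact_Icc (a := -|R|) (b := |R|)) fun r hr' => ?_
        refine (hR _ ?_).1
        rw [hnorm (r, θ)]
        refine (le_abs_self R).trans_lt ?_
        by_contra hle
        push Not at hle
        exact hr' (abs_le.1 hle)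
      have h3 := h2.integral_Ioi_deriv_eq h1 0
      simp only [(hr θ _).deriv] at h3
      simpa using h3
    simp only [Prod.swap_prod_mk, this]
    rw [setIntegral_const]
    simp only [Measure.real, Real.volume_Ioo, Complex.real_smul]
    rw [ENNReal.toReal_ofReal (by linarith [Real.pi_pos])]
    push_cast; ring
  have hint2 : ∫ p in Set.Ioi (0 : ℝ) ×ˢ Set.Ioo (-Real.pi) Real.pi, F2 p ∂(volume.prod volume)
      = 0 := by
    rw [setIntegral_prod _ hI2]
    refine setIntegral_eq_zero_of_forall_eq_zero fun r hr0 => ?_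
    have hr1 : (r : ℂ) ≠ 0 := by exact_mod_cast (ne_of_gt hr0)
    have h1 : Continuous fun θ : ℝ => (r : ℂ) * F2 (r, θ) := by fun_prop
    have h2 := intervalIntegral.integral_eq_sub_of_hasDerivAt (a := -Real.pi) (b := Real.pi)
      (fun θ _ => hθ r θ) (h1.intervalIntegrable _ _)
    have h3 : e (-Real.pi) = e Real.pi := by
      have := expI_periodic (-Real.pi) 1
      simp only [he]
      rw [← this]; congr 3; ring_nf
    rw [h3, sub_self, intervalIntegral.integral_of_le (by linarith [Real.pi_pos]),
      integral_Ioc_eq_integral_Ioo, integral_const_mul] at h2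
    exact (mul_eq_zero.1 h2).resolve_left hr1
  rw [hint1, hint2]
  ring

/-- The Cauchy–Pompeiu formula for compactly supported functions, at an arbitrary base point. -/
theorem integral_dbar_div {φ : ℂ → ℂ} (hφ : ContDiff ℝ 1 φ) (hc : HasCompactSupport φ) (z : ℂ) :
    ∫ w, dbar (fderiv ℝ φ w) / (w - z) = -(Real.pi * φ z) := by
  have h1 : ContDiff ℝ 1 fun w => φ (w + z) := hφ.comp (by fun_prop)
  have h2 : HasCompactSupport fun w => φ (w + z) := hc.comp_homeomorph (Homeomorph.addRight z)
  have h := integral_dbar_div_zero h1 h2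
  rw [zero_add] at h
  rw [← h, ← integral_add_right_eq_self _ z]
  simp only [fderiv_comp_add_right, add_sub_cancel_right]

/-! ### Wirtinger calculus -/

/-- The function `f` is real differentiable at `w` with `∂f/∂w̄ = b`. -/
def HasDbarAt (f : ℂ → ℂ) (b w : ℂ) : Prop := ∃ L : ℂ →L[ℝ] ℂ, HasFDerivAt f L w ∧ dbar L = b

lemma HasDbarAt.dbar_fderiv {f : ℂ → ℂ} {b w : ℂ} (h : HasDbarAt f b w) :
    dbar (fderiv ℝ f w) = b := by
  obtain ⟨L, hL, rfl⟩ := h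
  rw [hL.fderiv]

lemma HasDbarAt.mul {f g : ℂ → ℂ} {a b w : ℂ} (hf : HasDbarAt f a w) (hg : HasDbarAt g b w) :
    HasDbarAt (fun w => f w * g w) (a * g w + f w * b) w := by
  obtain ⟨L, hL, rfl⟩ := hf
  obtain ⟨M, hM, rfl⟩ := hg
  refine ⟨_, hL.mul hM, ?_⟩
  simp [dbar]
  ring

lemma hasDbarAt_of_differentiableAt {f : ℂ → ℂ} {w : ℂ} (hf : DifferentiableAt ℂ f w) :
    HasDbarAt f 0 w := by
  refine ⟨_, hf.hasFDerivAt.restrictScalars ℝ, ?_⟩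
  have h : fderiv ℂ f w Complex.I = Complex.I * fderiv ℂ f w 1 := by
    conv_lhs => rw [show Complex.I = Complex.I • (1 : ℂ) by simp]
    rw [map_smul, smul_eq_mul]
  simp only [dbar, ContinuousLinearMap.coe_restrictScalars', h]
  linear_combination (fderiv ℂ f w 1 / 2) * Complex.I_sq

lemma HasDbarAt.comp {f g : ℂ → ℂ} {b c w : ℂ} (hf : HasDbarAt f b w)
    (hg : HasDerivAt g c (f w)) : HasDbarAt (fun w => g (f w)) (c * b) w := by
  obtain ⟨L, hL, rfl⟩ := hf
  refine ⟨_, (hg.hasFDerivAt.restrictScalars ℝ).comp w hL, ?_⟩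
  simp [dbar]
  ring

lemma hasFDerivAt_bdf (w : ℂ) :
    HasFDerivAt bdf (-((2 * w.re) • Complex.reCLM + (2 * w.im) • Complex.imCLM)) w := by
  have h : bdf = fun w => 1 - (w.re * w.re + w.im * w.im) := by
    funext w; rw [bdf, ← Complex.normSq_eq_norm_sq, Complex.normSq_apply]
  rw [h]
  have hre := Complex.reCLM.hasFDerivAt (x := w)
  have him := Complex.imCLM.hasFDerivAt (x := w)
  refine (((hre.mul hre).add (him.mul him)).const_sub 1).congr_fderiv ?_
  ext
  simp
  ring

lemma hasDbarAt_bdf (w : ℂ) : HasDbarAt (fun w => (bdf w : ℂ)) (-w) w := by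
  refine ⟨_, Complex.ofRealCLM.hasFDerivAt.comp w (hasFDerivAt_bdf w), ?_⟩
  apply Complex.ext <;> (simp [dbar]; ring)

lemma hasDbarAt_comp_bdf {g : ℝ → ℝ} {g' : ℝ} {w : ℂ} (hg : HasDerivAt g g' (bdf w)) :
    HasDbarAt (fun w => (g (bdf w) : ℂ)) (-(g' * w)) w := by
  refine ⟨_, Complex.ofRealCLM.hasFDerivAt.comp w (hg.comp_hasFDerivAt w (hasFDerivAt_bdf w)), ?_⟩
  apply Complex.ext <;> simp [dbar] <;> ring

/-! ### The reproducing property -/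

/-- A smooth radial cutoff, equal to `1` where `n d ≥ 2` and to `0` where `n d ≤ 1`. -/
def cutoff (n : ℕ) (w : ℂ) : ℝ := Real.smoothTransition (n * bdf w - 1)

/-- The conjugate of the base of the kernel. -/
def conjBase (z v w : ℂ) : ℂ := 1 - conj w * z + conj v ^ 2 * z * (w - z)

/-- A function whose derivative `∂/∂w̄`, divided by `z - w`, is a constant multiple of `a` times
the conjugate of the kernel times `d^γ`. It vanishes on the boundary, and its value at `z` is
`a z`. -/
def primitive (γ : ℝ) (a : ℂ → ℂ) (z v w : ℂ) : ℂ :=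
  a w * ((1 + conj v ^ 2 * z ^ 2) / (1 + conj v ^ 2 * z * w)) *
    ((bdf w : ℂ) ^ ((γ : ℂ) + 1) * conjBase z v w ^ (-((γ : ℂ) + 1)))

lemma conj_kernelBase (z v w : ℂ) : conj (kernelBase z w v) = conjBase z v w := by
  simp [kernelBase, conjBase]

lemma conjBase_mem_slitPlane {z w v : ℂ} (hz : ‖z‖ < 1) (hw : ‖w‖ ≤ 1) (hv : ‖v‖ ≤ 1) :
    conjBase z v w ∈ Complex.slitPlane := by
  have h := kernelBase_mem_slitPlane hz hw hv
  rw [← conj_kernelBase]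
  rw [Complex.mem_slitPlane_iff] at h ⊢
  simpa using h

lemma sq_le_norm_conjBase {z w v : ℂ} (hz : ‖z‖ < 1) (hw : ‖w‖ ≤ 1) (hv : ‖v‖ ≤ 1) :
    (1 - ‖z‖) ^ 2 ≤ ‖conjBase z v w‖ := by
  rw [← conj_kernelBase, Complex.norm_conj]
  exact sq_le_norm_kernelBase hz hw hv

lemma conj_bundleKernel (γ : ℝ) {z w v : ℂ} (hz : ‖z‖ < 1) (hw : ‖w‖ ≤ 1) (hv : ‖v‖ ≤ 1) :
    conj (bundleKernel γ z (w, v)) = ((γ : ℂ) + 1) / (2 * (Real.pi : ℂ) ^ 2) *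
      (1 + conj v ^ 2 * z ^ 2) / conjBase z v w ^ ((γ : ℂ) + 2) := by
  have h := Complex.slitPlane_arg_ne_pi (kernelBase_mem_slitPlane hz hw hv)
  have h2 : conj (kernelBase z w v ^ ((γ : ℂ) + 2)) = conjBase z v w ^ ((γ : ℂ) + 2) := by
    rw [← conj_kernelBase, Complex.conj_cpow _ _ h, map_add, Complex.conj_ofReal, map_ofNat]
  simp only [bundleKernel]
  rw [map_div₀, h2]
  simp [map_ofNat]

lemma norm_conj_sq_mul_le {z w v : ℂ} (hw : ‖w‖ ≤ 1) (hv : ‖v‖ ≤ 1) :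
    ‖conj v ^ 2 * z * w‖ ≤ ‖z‖ := by
  rw [norm_mul, norm_mul, norm_pow, Complex.norm_conj]
  have h1 : ‖v‖ ^ 2 ≤ 1 := pow_le_one₀ (norm_nonneg _) hv
  calc ‖v‖ ^ 2 * ‖z‖ * ‖w‖ ≤ 1 * ‖z‖ * 1 := by gcongr
    _ = ‖z‖ := by ring

lemma one_sub_norm_le_norm_one_add {z w v : ℂ} (hw : ‖w‖ ≤ 1) (hv : ‖v‖ ≤ 1) :
    1 - ‖z‖ ≤ ‖1 + conj v ^ 2 * z * w‖ := by
  have := norm_sub_norm_le (1 : ℂ) (-(conj v ^ 2 * z * w))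
  rw [norm_one, norm_neg, sub_neg_eq_add] at this
  linarith [norm_conj_sq_mul_le (z := z) hw hv]

lemma one_add_ne_zero {z w v : ℂ} (hz : ‖z‖ < 1) (hw : ‖w‖ ≤ 1) (hv : ‖v‖ ≤ 1) :
    1 + conj v ^ 2 * z * w ≠ 0 :=
  norm_pos_iff.1 (lt_of_lt_of_le (by linarith) (one_sub_norm_le_norm_one_add hw hv))

lemma hasDbarAt_conjBase (z v w : ℂ) : HasDbarAt (conjBase z v) (-z) w := by
  have h1 : HasFDerivAt (fun w : ℂ => conj w) (Complex.conjCLE : ℂ →L[ℝ] ℂ) w :=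
    Complex.conjCLE.hasFDerivAt
  have h2 : HasFDerivAt (fun w : ℂ => w) (ContinuousLinearMap.id ℝ ℂ) w := hasFDerivAt_id w
  refine ⟨_, ((h1.mul_const z).const_sub 1).add ((h2.sub_const z).const_mul (conj v ^ 2 * z)), ?_⟩
  simp [dbar]
  linear_combination ((z - conj v ^ 2 * z) / 2 + conj v ^ 2 * z) * Complex.I_sq

lemma bdf_mem_slitPlane {w : ℂ} (hw : w ∈ Metric.ball (0 : ℂ) 1) :
    (bdf w : ℂ) ∈ Complex.slitPlane :=
  Complex.ofReal_mem_slitPlane.2 (bdf_pos_iff.2 hw)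

lemma HasDbarAt.congr_value {f : ℂ → ℂ} {b c w : ℂ} (h : HasDbarAt f b w) (e : b = c) :
    HasDbarAt f c w := e ▸ h

lemma HasDbarAt.cpow_const {f : ℂ → ℂ} {b w : ℂ} (h : HasDbarAt f b w) (c : ℂ)
    (hf : f w ∈ Complex.slitPlane) :
    HasDbarAt (fun w => f w ^ c) (c * f w ^ (c - 1) * b) w := by
  have h1 := ((hasStrictDerivAt_id (f w)).cpow_const (c := c) hf).hasDerivAt
  simp only [id, mul_one] at h1
  exact h.comp h1

/-- The derivatives of the two powers in `primitive` combine through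
`-w b̄ + z d = (z - w) (1 + v̄² z w)`, where `b̄` is the conjugate base. -/
lemma hasDbarAt_primitive {γ : ℝ} {a : ℂ → ℂ} {z v w : ℂ}
    (ha : DifferentiableAt ℂ a w) (hz : ‖z‖ < 1) (hw : w ∈ Metric.ball (0 : ℂ) 1)
    (hv : ‖v‖ ≤ 1) :
    HasDbarAt (primitive γ a z v)
      ((z - w) * (a w * ((1 + conj v ^ 2 * z ^ 2) * ((γ : ℂ) + 1)
        / conjBase z v w ^ ((γ : ℂ) + 2) * ((bdf w ^ γ : ℝ) : ℂ)))) w := by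
  have hw1 : ‖w‖ ≤ 1 := (mem_ball_zero_iff.1 hw).le
  have hd := bdf_mem_slitPlane hw
  have hB := conjBase_mem_slitPlane hz hw1 hv
  have hA := one_add_ne_zero (v := v) hz hw1 hv
  have h1 : HasDbarAt (fun w => a w * ((1 + conj v ^ 2 * z ^ 2) / (1 + conj v ^ 2 * z * w))) 0 w :=
    hasDbarAt_of_differentiableAt (by fun_prop (disch := assumption))
  have h := h1.mul (((hasDbarAt_bdf w).cpow_const ((γ : ℂ) + 1) hd).mul
    ((hasDbarAt_conjBase z v w).cpow_const (-((γ : ℂ) + 1)) hB))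
  have hd0 : (bdf w : ℂ) ≠ 0 := Complex.slitPlane_ne_zero hd
  have hB0 := Complex.slitPlane_ne_zero hB
  have e1 : (bdf w : ℂ) ^ ((γ : ℂ) + 1) = (bdf w : ℂ) ^ (γ : ℂ) * bdf w := by
    rw [Complex.cpow_add _ _ hd0, Complex.cpow_one]
  have e2 : conjBase z v w ^ (-((γ : ℂ) + 1) - 1) = (conjBase z v w ^ ((γ : ℂ) + 2))⁻¹ := by
    rw [← Complex.cpow_neg]; congr 1; ring
  have e3 : conjBase z v w ^ (-((γ : ℂ) + 1))
      = (conjBase z v w ^ ((γ : ℂ) + 2))⁻¹ * conjBase z v w := by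
    rw [← Complex.cpow_neg, show -((γ : ℂ) + 1) = -((γ : ℂ) + 2) + 1 by ring,
      Complex.cpow_add _ _ hB0, Complex.cpow_one]
  have e4 : ((bdf w ^ γ : ℝ) : ℂ) = (bdf w : ℂ) ^ (γ : ℂ) :=
    Complex.ofReal_cpow (bdf_pos_iff.2 hw).le γ
  have key : -w * conjBase z v w + z * (bdf w : ℂ)
      = (z - w) * (1 + conj v ^ 2 * z * w) := by
    have : (bdf w : ℂ) = 1 - w * conj w := by
      rw [Complex.mul_conj, Complex.normSq_eq_norm_sq, bdf]; push_cast; rfl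
    rw [this, conjBase]; ring
  refine h.congr_value ?_
  rw [add_sub_cancel_right, e1, e2, e3, e4]
  field_simp
  linear_combination (a w * ((γ : ℂ) + 1) * (1 + conj v ^ 2 * z ^ 2) * (bdf w : ℂ) ^ (γ : ℂ)
    * (conjBase z v w ^ ((γ : ℂ) + 2))⁻¹) * key

lemma deriv_smoothTransition_eq_zero {x : ℝ} (hx : x ∉ Set.Icc (0 : ℝ) 1) :
    deriv Real.smoothTransition x = 0 := by
  rcases lt_or_ge x 0 with h | h
  · have : Real.smoothTransition =ᶠ[𝓝 x] fun _ => 0 := by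
      filter_upwards [eventually_lt_nhds h] with y hy
      exact Real.smoothTransition.zero_of_nonpos hy.le
    rw [this.deriv_eq]; simp
  · have h1 : 1 < x := by
      by_contra hle
      exact hx ⟨h, not_lt.1 hle⟩
    have : Real.smoothTransition =ᶠ[𝓝 x] fun _ => 1 := by
      filter_upwards [eventually_gt_nhds h1] with y hy
      exact Real.smoothTransition.one_of_one_le hy.le
    rw [this.deriv_eq]; simp

lemma exists_bound_deriv_smoothTransition :
    ∃ M : ℝ, 0 ≤ M ∧ ∀ x, |deriv Real.smoothTransition x| ≤ M := by
  have hc : Continuous (deriv Real.smoothTransition) :=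
    (Real.smoothTransition.contDiff (n := 1)).continuous_deriv le_rfl
  obtain ⟨M, hM⟩ := isCompact_Icc.exists_bound_of_continuousOn (s := Set.Icc (0 : ℝ) 1)
    hc.continuousOn
  refine ⟨max M 0, le_max_right _ _, fun x => ?_⟩
  by_cases hx : x ∈ Set.Icc (0 : ℝ) 1
  · exact (hM x hx).trans (le_max_left _ _)
  · rw [deriv_smoothTransition_eq_zero hx]; simp

lemma norm_primitive_le {γ : ℝ} (hγ : -1 < γ) (a : ℂ → ℂ) {z v w : ℂ} (hz : ‖z‖ < 1)
    (hw : w ∈ Metric.ball (0 : ℂ) 1) (hv : ‖v‖ ≤ 1) :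
    ‖primitive γ a z v w‖ ≤
      2 / (1 - ‖z‖) * ((1 - ‖z‖) ^ 2) ^ (-(γ + 1)) * (‖a w‖ * bdf w ^ γ) * bdf w := by
  have hw1 : ‖w‖ ≤ 1 := (mem_ball_zero_iff.1 hw).le
  have hd := bdf_pos_iff.2 hw
  have hB0 := Complex.slitPlane_ne_zero (conjBase_mem_slitPlane hz hw1 hv)
  have hz1 : 0 < 1 - ‖z‖ := by linarith
  have h1 : ‖(bdf w : ℂ) ^ ((γ : ℂ) + 1)‖ = bdf w ^ γ * bdf w := by
    rw [Complex.norm_cpow_eq_rpow_re_of_pos hd, Complex.add_re, Complex.ofReal_re, Complex.one_re,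
      Real.rpow_add hd, Real.rpow_one]
  have h2 : ‖conjBase z v w ^ (-((γ : ℂ) + 1))‖ ≤ ((1 - ‖z‖) ^ 2) ^ (-(γ + 1)) := by
    rw [Complex.norm_cpow_of_ne_zero hB0]
    have e1 : (-((γ : ℂ) + 1)).re = -(γ + 1) := by simp
    have e2 : (-((γ : ℂ) + 1)).im = 0 := by simp
    rw [e1, e2, mul_zero, Real.exp_zero, div_one]
    exact Real.rpow_le_rpow_of_nonpos (by positivity) (sq_le_norm_conjBase hz hw1 hv) (by linarith)
  have h3 : ‖(1 + conj v ^ 2 * z ^ 2) / (1 + conj v ^ 2 * z * w)‖ ≤ 2 / (1 - ‖z‖) := by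
    rw [norm_div]
    refine div_le_div₀ zero_le_two ?_ hz1 (one_sub_norm_le_norm_one_add hw1 hv)
    refine (norm_add_le _ _).trans ?_
    have := norm_conj_sq_mul_le (z := z) (w := z) hz.le hv
    rw [norm_one, sq z, ← mul_assoc]
    linarith
  rw [primitive, norm_mul, norm_mul, norm_mul, h1]
  have h4 : 0 ≤ bdf w ^ γ * bdf w := by positivity
  calc ‖a w‖ * ‖(1 + conj v ^ 2 * z ^ 2) / (1 + conj v ^ 2 * z * w)‖ *
        (bdf w ^ γ * bdf w * ‖conjBase z v w ^ (-((γ : ℂ) + 1))‖)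
      ≤ ‖a w‖ * (2 / (1 - ‖z‖)) *
        (bdf w ^ γ * bdf w * ((1 - ‖z‖) ^ 2) ^ (-(γ + 1))) := by gcongr
    _ = _ := by ring

lemma primitive_self (γ : ℝ) (a : ℂ → ℂ) {z v : ℂ} (hz : ‖z‖ < 1) (hv : ‖v‖ ≤ 1) :
    primitive γ a z v z = a z := by
  have h1 : conjBase z v z = (bdf z : ℂ) := by
    have : (bdf z : ℂ) = 1 - z * conj z := by
      rw [Complex.mul_conj, Complex.normSq_eq_norm_sq, bdf]; push_cast; rfl
    rw [conjBase, this]; ring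
  have h2 : (bdf z : ℂ) ≠ 0 := by
    exact_mod_cast (bdf_pos_iff.2 (mem_ball_zero_iff.2 hz)).ne'
  have h3 := one_add_ne_zero (v := v) hz hz.le hv
  rw [primitive, h1, ← Complex.cpow_add _ _ h2, add_neg_cancel, Complex.cpow_zero, mul_one,
    sq z, ← mul_assoc, div_self h3, mul_one]

lemma hasDbarAt_cutoff (n : ℕ) (w : ℂ) :
    HasDbarAt (fun w => (cutoff n w : ℂ))
      (-((deriv Real.smoothTransition (n * bdf w - 1) * n : ℝ) * w)) w := by
  have h1 : HasDerivAt Real.smoothTransition (deriv Real.smoothTransition (n * bdf w - 1))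
      (n * bdf w - 1) :=
    ((Real.smoothTransition.contDiff (n := 1)).differentiable one_ne_zero _).hasDerivAt
  have h2 : HasDerivAt (fun x : ℝ => n * x - 1) (n : ℝ) (bdf w) := by
    simpa using ((hasDerivAt_id (bdf w)).const_mul (n : ℝ)).sub_const 1
  exact hasDbarAt_comp_bdf (h1.comp (bdf w) h2)

lemma contDiff_bdf {n : WithTop ℕ∞} : ContDiff ℝ n bdf := by
  unfold bdf
  exact contDiff_const.sub (contDiff_norm_sq ℝ)

lemma contDiff_cutoff (n : ℕ) : ContDiff ℝ 1 (fun w => (cutoff n w : ℂ)) := by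
  refine Complex.ofRealCLM.contDiff.comp ?_
  exact (Real.smoothTransition.contDiff (n := 1)).comp
    ((contDiff_const.mul contDiff_bdf).sub contDiff_const)

lemma cutoff_mul_eventually_eq_zero {n : ℕ} (f : ℂ → ℂ) {w : ℂ} (hw : n * bdf w < 1) :
    (fun w => (cutoff n w : ℂ) * f w) =ᶠ[𝓝 w] fun _ => 0 := by
  have hc : Continuous fun w => n * bdf w :=
    continuous_const.mul (contDiff_bdf (n := 0)).continuous
  filter_upwards [hc.continuousAt.eventually (eventually_lt_nhds hw)] with y hy
  rw [cutoff, Real.smoothTransition.zero_of_nonpos (by linarith)]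
  simp

lemma contDiffAt_primitive {γ : ℝ} {a : ℂ → ℂ} {z v w : ℂ}
    (ha : DifferentiableOn ℂ a (Metric.ball 0 1)) (hz : ‖z‖ < 1)
    (hw : w ∈ Metric.ball (0 : ℂ) 1) (hv : ‖v‖ ≤ 1) :
    ContDiffAt ℝ 1 (primitive γ a z v) w := by
  have hw1 : ‖w‖ ≤ 1 := (mem_ball_zero_iff.1 hw).le
  have hnhds : Metric.ball (0 : ℂ) 1 ∈ 𝓝 w := Metric.isOpen_ball.mem_nhds hw
  have hA := one_add_ne_zero (v := v) hz hw1 hv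
  have h1 : ContDiffAt ℝ 1 a w :=
    ((ha.contDiffOn (n := 1) Metric.isOpen_ball).contDiffAt hnhds).restrict_scalars ℝ
  have h2 : ContDiffAt ℝ 1 (fun w => (1 + conj v ^ 2 * z ^ 2) / (1 + conj v ^ 2 * z * w)) w :=
    (contDiffAt_const.div (contDiffAt_const.add (contDiffAt_const.mul contDiffAt_id))
      hA).restrict_scalars ℝ
  have hpow : ∀ (c : ℂ) {x : ℂ}, x ∈ Complex.slitPlane → ContDiffAt ℝ 1 (fun x : ℂ => x ^ c) x :=
    fun c x hx => ((analyticAt_id.cpow analyticAt_const hx).contDiffAt (n := 1)).restrict_scalars ℝ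
  have h3 : ContDiffAt ℝ 1 (fun w => (bdf w : ℂ) ^ ((γ : ℂ) + 1)) w :=
    (hpow _ (bdf_mem_slitPlane hw)).comp w (f := fun w => (bdf w : ℂ))
      (Complex.ofRealCLM.contDiff.comp contDiff_bdf).contDiffAt
  have hconj : ContDiff ℝ 1 (fun w : ℂ => conj w) := Complex.conjCLE.contDiff
  have h4 : ContDiffAt ℝ 1 (fun w => conjBase z v w ^ (-((γ : ℂ) + 1))) w := by
    refine (hpow _ (conjBase_mem_slitPlane hz hw1 hv)).comp w (f := conjBase z v) ?_
    unfold conjBase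
    exact ((contDiff_const.sub (hconj.mul contDiff_const)).add
      (contDiff_const.mul (contDiff_id.sub contDiff_const))).contDiffAt
  exact (h1.mul h2).mul (h3.mul h4)

lemma contDiff_cutoff_mul_primitive {γ : ℝ} {a : ℂ → ℂ} {z v : ℂ}
    (ha : DifferentiableOn ℂ a (Metric.ball 0 1)) (hz : ‖z‖ < 1) (hv : ‖v‖ ≤ 1) (n : ℕ) :
    ContDiff ℝ 1 (fun w => (cutoff n w : ℂ) * primitive γ a z v w) := by
  rw [contDiff_iff_contDiffAt]
  intro w
  by_cases hw : w ∈ Metric.ball (0 : ℂ) 1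
  · exact (contDiff_cutoff n).contDiffAt.mul (contDiffAt_primitive ha hz hw hv)
  · have hb : bdf w ≤ 0 := not_lt.1 fun h => hw (bdf_pos_iff.1 h)
    have h1 : n * bdf w < 1 := by
      have : (0 : ℝ) ≤ n := Nat.cast_nonneg n
      nlinarith
    exact contDiffAt_const.congr_of_eventuallyEq (cutoff_mul_eventually_eq_zero _ h1)

lemma hasCompactSupport_cutoff_mul (n : ℕ) (f : ℂ → ℂ) :
    HasCompactSupport fun w => (cutoff n w : ℂ) * f w := by
  refine HasCompactSupport.intro (isCompact_closedBall (0 : ℂ) 1) fun w hw => ?_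
  have hb : bdf w ≤ 0 := not_lt.1 fun h => hw (Metric.ball_subset_closedBall (bdf_pos_iff.1 h))
  have h1 : n * bdf w < 1 := by
    have : (0 : ℝ) ≤ n := Nat.cast_nonneg n
    nlinarith
  exact (cutoff_mul_eventually_eq_zero f h1).self_of_nhds

lemma integral_diskMeasure (γ : ℝ) (f : ℂ → ℂ) :
    ∫ w, f w ∂(diskMeasure γ)
      = ∫ w in Metric.ball (0 : ℂ) 1, f w * ((bdf w ^ γ : ℝ) : ℂ) := by
  rw [diskMeasure, integral_withDensity_eq_integral_toReal_smul
    (measurable_bdf.pow_const γ).ennreal_ofReal (ae_of_all _ fun _ => ENNReal.ofReal_lt_top)]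
  refine setIntegral_congr_fun measurableSet_ball fun w hw => ?_
  rw [ENNReal.toReal_ofReal (Real.rpow_pos_of_pos (bdf_pos_iff.2 hw) γ).le, Complex.real_smul,
    mul_comm]

lemma integrable_diskMeasure_iff (γ : ℝ) (f : ℂ → ℂ) :
    Integrable f (diskMeasure γ)
      ↔ IntegrableOn (fun w => f w * ((bdf w ^ γ : ℝ) : ℂ)) (Metric.ball 0 1) := by
  rw [diskMeasure, integrable_withDensity_iff_integrable_smul'
    (measurable_bdf.pow_const γ).ennreal_ofReal (ae_of_all _ fun _ => ENNReal.ofReal_lt_top)]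
  refine integrable_congr ?_
  filter_upwards [ae_restrict_mem measurableSet_ball] with w hw
  rw [ENNReal.toReal_ofReal (Real.rpow_pos_of_pos (bdf_pos_iff.2 hw) γ).le, Complex.real_smul,
    mul_comm]

/-- The derivative `∂/∂w̄` of the truncated primitive: a term from the cutoff, supported near the
boundary, and the truncated integrand of the reproducing formula. -/
lemma dbar_cutoff_mul_primitive {γ : ℝ} {a : ℂ → ℂ}
    (ha : DifferentiableOn ℂ a (Metric.ball 0 1)) {z v w : ℂ} (hz : ‖z‖ < 1)
    (hw : w ∈ Metric.ball (0 : ℂ) 1) (hv : ‖v‖ ≤ 1) (n : ℕ) :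
    dbar (fderiv ℝ (fun w => (cutoff n w : ℂ) * primitive γ a z v w) w)
      = -((deriv Real.smoothTransition (n * bdf w - 1) * n : ℝ) * w) * primitive γ a z v w
        + cutoff n w * ((z - w) * (2 * (Real.pi : ℂ) ^ 2 *
          (a w * conj (bundleKernel γ z (w, v)) * ((bdf w ^ γ : ℝ) : ℂ)))) := by
  have hpi : (Real.pi : ℂ) ≠ 0 := by exact_mod_cast Real.pi_ne_zero
  have h := (hasDbarAt_cutoff n w).mul (hasDbarAt_primitive (γ := γ)
    (ha.differentiableAt (Metric.isOpen_ball.mem_nhds hw)) hz hw hv)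
  rw [h.dbar_fderiv, conj_bundleKernel γ hz (mem_ball_zero_iff.1 hw).le hv]
  field_simp

lemma le_norm_sub_of_bdf_le {z w : ℂ} (hz : ‖z‖ < 1) (hw : ‖w‖ < 1) (h : 2 * bdf w ≤ bdf z) :
    bdf z / 4 ≤ ‖w - z‖ := by
  have h1 := norm_sub_norm_le w z
  simp only [bdf] at *
  nlinarith [norm_nonneg z, norm_nonneg w, norm_nonneg (w - z)]

/-- The weighted reproducing formula for a fixed direction `v`: the kernel reproduces analytic
functions before any averaging over `v`. It is the Cauchy–Pompeiu formula for the truncations of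
`primitive`; the derivative of the cutoff at scale `1/n` is compensated by the additional factor
`d` that `primitive` has over the integrand. -/
theorem integral_mul_conj_bundleKernel {γ : ℝ} (hγ : -1 < γ) {a : ℂ → ℂ}
    (ha : DifferentiableOn ℂ a (Metric.ball 0 1)) (hi : Integrable a (diskMeasure γ))
    {z v : ℂ} (hz : z ∈ Metric.ball (0 : ℂ) 1) (hv : ‖v‖ ≤ 1) :
    ∫ w, a w * conj (bundleKernel γ z (w, v)) ∂(diskMeasure γ) = a z / (2 * Real.pi) := by
  have hz1 : ‖z‖ < 1 := mem_ball_zero_iff.1 hz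
  have hdz : 0 < bdf z := bdf_pos_iff.2 hz
  obtain ⟨M, hM0, hM⟩ := exists_bound_deriv_smoothTransition
  -- With `4 ≤ n d(z)` the cutoff is `1` at `z`, and it is constant near `z`, so that the factor
  -- `1 / (w - z)` is bounded on the support of its derivative.
  obtain ⟨N, hN⟩ := exists_nat_gt (4 / bdf z)
  have hN4 : ∀ n : ℕ, 4 ≤ ((n + N : ℕ) : ℝ) * bdf z := fun n => by
    have h1 := (div_lt_iff₀ hdz).1 hN
    have h2 : (N : ℝ) ≤ ((n + N : ℕ) : ℝ) := by push_cast; linarith [Nat.cast_nonneg (α := ℝ) n]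
    nlinarith
  set φ : ℕ → ℂ → ℂ := fun n w => (cutoff (n + N) w : ℂ) * primitive γ a z v w with hφ
  have hφc : ∀ n, ContDiff ℝ 1 (φ n) := fun n => contDiff_cutoff_mul_primitive ha hz1 hv _
  have hφs : ∀ n, HasCompactSupport (φ n) := fun n => hasCompactSupport_cutoff_mul _ _
  set F : ℕ → ℂ → ℂ := fun n w => dbar (fderiv ℝ (φ n) w) / (w - z) with hF
  set Q : ℂ → ℂ := fun w => a w * conj (bundleKernel γ z (w, v)) * ((bdf w ^ γ : ℝ) : ℂ) with hQ
  have hFint : ∀ n, ∫ w in Metric.ball (0 : ℂ) 1, F n w = -(Real.pi * a z) := fun n => by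
    rw [setIntegral_eq_integral_of_forall_compl_eq_zero]
    · rw [integral_dbar_div (hφc n) (hφs n) z]
      simp only [hφ]
      rw [primitive_self γ a hz1 hv, cutoff,
        Real.smoothTransition.one_of_one_le (by linarith [hN4 n])]
      simp
    · intro w hw
      have hb : bdf w ≤ 0 := not_lt.1 fun h => hw (bdf_pos_iff.1 h)
      have h1 : ((n + N : ℕ) : ℝ) * bdf w < 1 := by
        have : (0 : ℝ) ≤ ((n + N : ℕ) : ℝ) := Nat.cast_nonneg _
        nlinarith
      simp only [hF, hφ]
      rw [(cutoff_mul_eventually_eq_zero (primitive γ a z v) h1).fderiv_eq]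
      simp [dbar]
  set C0 : ℝ := 2 / (1 - ‖z‖) * ((1 - ‖z‖) ^ 2) ^ (-(γ + 1)) with hC0
  have hz2 : 0 < 1 - ‖z‖ := by linarith
  have hC00 : 0 ≤ C0 := by positivity
  set C : ℝ := M * 2 * C0 / (bdf z / 4) + 2 * Real.pi ^ 2 * kernelBound γ z with hC
  have hlim : Tendsto (fun n => ∫ w in Metric.ball (0 : ℂ) 1, F n w) atTop
      (𝓝 (∫ w in Metric.ball (0 : ℂ) 1, -(2 * (Real.pi : ℂ) ^ 2 * Q w))) := by
    refine tendsto_integral_of_dominated_convergence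
      (fun w => C * ‖a w * ((bdf w ^ γ : ℝ) : ℂ)‖) (fun n => ?_) ?_ (fun n => ?_) ?_
    · have h1 : Continuous fun w => dbar (fderiv ℝ (φ n) w) := by
        have := (hφc n).continuous_fderiv one_ne_zero
        unfold dbar; fun_prop
      exact (h1.measurable.div (by fun_prop)).aestronglyMeasurable
    · exact (((integrable_diskMeasure_iff γ a).1 hi).norm).const_mul C
    · filter_upwards [ae_restrict_mem measurableSet_ball] with w hw
      have hw1 : ‖w‖ < 1 := mem_ball_zero_iff.1 hw
      have hdw : 0 < bdf w := bdf_pos_iff.2 hw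
      have hA0 : 0 ≤ ‖a w‖ * bdf w ^ γ := by positivity
      have hAn : ‖a w * ((bdf w ^ γ : ℝ) : ℂ)‖ = ‖a w‖ * bdf w ^ γ := by
        rw [norm_mul, Complex.norm_real, Real.norm_of_nonneg (by positivity)]
      have hkb := norm_bundleKernel_le hγ hz1 hw1.le hv
      have hk0 : 0 ≤ kernelBound γ z := (norm_nonneg _).trans hkb
      have hCnn : 0 ≤ C := by positivity
      simp only [hF]
      -- At `w = z` the quotient is `0` by the convention for division by zero.
      rcases eq_or_ne w z with rfl | hne
      · rw [sub_self, div_zero, norm_zero]; positivity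
      have hpos : 0 < ‖w - z‖ := norm_pos_iff.2 (sub_ne_zero.2 hne)
      simp only [hφ]
      rw [dbar_cutoff_mul_primitive ha hz1 hw hv, norm_div, div_le_iff₀ hpos]
      refine (norm_add_le _ _).trans ?_
      have hT2 : ‖(cutoff (n + N) w : ℂ) * ((z - w) * (2 * (Real.pi : ℂ) ^ 2 *
          (a w * conj (bundleKernel γ z (w, v)) * ((bdf w ^ γ : ℝ) : ℂ))))‖
          ≤ 2 * Real.pi ^ 2 * kernelBound γ z * (‖a w‖ * bdf w ^ γ) * ‖w - z‖ := by
        have hχ : ‖(cutoff (n + N) w : ℂ)‖ ≤ 1 := by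
          rw [Complex.norm_real, cutoff, Real.norm_of_nonneg (Real.smoothTransition.nonneg _)]
          exact Real.smoothTransition.le_one _
        have hpi : ‖(2 * (Real.pi : ℂ) ^ 2)‖ = 2 * Real.pi ^ 2 := by
          rw [norm_mul, norm_pow, Complex.norm_real, Real.norm_of_nonneg Real.pi_pos.le]; simp
        rw [norm_mul, norm_mul, norm_mul (2 * (Real.pi : ℂ) ^ 2), hpi, mul_right_comm (a w),
          norm_mul (a w * _), hAn, Complex.norm_conj, norm_sub_rev]
        calc ‖(cutoff (n + N) w : ℂ)‖ * (‖w - z‖ * (2 * Real.pi ^ 2 *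
              (‖a w‖ * bdf w ^ γ * ‖bundleKernel γ z (w, v)‖)))
            ≤ 1 * (‖w - z‖ * (2 * Real.pi ^ 2 * (‖a w‖ * bdf w ^ γ * kernelBound γ z))) := by
              gcongr
          _ = _ := by ring
      have hT1 : ‖-(((deriv Real.smoothTransition ((n + N : ℕ) * bdf w - 1) * (n + N : ℕ) : ℝ) : ℂ)
          * w) * primitive γ a z v w‖
          ≤ M * 2 * C0 / (bdf z / 4) * (‖a w‖ * bdf w ^ γ) * ‖w - z‖ := by
        -- The derivative of the cutoff lives where `1 ≤ n d(w) ≤ 2`; there it is `O(n)`, and the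
        -- primitive is `O(d)` times the integrable function `|a| d^γ`.
        by_cases hmem : ((n + N : ℕ) : ℝ) * bdf w - 1 ∈ Set.Icc (0 : ℝ) 1
        · have hle2 : ((n + N : ℕ) : ℝ) * bdf w ≤ 2 := by linarith [hmem.2]
          have hnpos : (0 : ℝ) < ((n + N : ℕ) : ℝ) := by
            by_contra hneg
            nlinarith [hN4 n]
          have h2d : 2 * bdf w ≤ bdf z := by
            by_contra hneg
            push Not at hneg
            nlinarith [hN4 n, mul_lt_mul_of_pos_left hneg hnpos]
          have hδ := le_norm_sub_of_bdf_le hz1 hw1 h2d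
          have hP := norm_primitive_le hγ a hz1 hw hv
          rw [norm_mul, norm_neg, norm_mul, Complex.norm_real, norm_mul, Real.norm_eq_abs,
            Real.norm_of_nonneg hnpos.le]
          calc |deriv Real.smoothTransition (((n + N : ℕ) : ℝ) * bdf w - 1)| * ((n + N : ℕ) : ℝ)
                * ‖w‖ * ‖primitive γ a z v w‖
              ≤ M * ((n + N : ℕ) : ℝ) * 1 * (C0 * (‖a w‖ * bdf w ^ γ) * bdf w) := by
                gcongr
                exact hM _
            _ = M * C0 * (‖a w‖ * bdf w ^ γ) * (((n + N : ℕ) : ℝ) * bdf w) := by ring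
            _ ≤ M * C0 * (‖a w‖ * bdf w ^ γ) * 2 := by gcongr
            _ = M * 2 * C0 / (bdf z / 4) * (‖a w‖ * bdf w ^ γ) * (bdf z / 4) := by
                field_simp
            _ ≤ M * 2 * C0 / (bdf z / 4) * (‖a w‖ * bdf w ^ γ) * ‖w - z‖ := by gcongr
        · rw [deriv_smoothTransition_eq_zero hmem]
          simp only [zero_mul, Complex.ofReal_zero, neg_zero, norm_zero]
          positivity
      rw [hAn]
      refine (add_le_add hT1 hT2).trans (le_of_eq ?_)
      rw [hC]; ring
    -- For fixed `w` the truncation has no effect near `w` once `n d(w) > 2`.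
    · have hne : ∀ᵐ w ∂(volume.restrict (Metric.ball (0 : ℂ) 1)), w ≠ z :=
        ae_restrict_of_ae (by simp [ae_iff])
      filter_upwards [ae_restrict_mem measurableSet_ball, hne] with w hw hwz
      have hdw : 0 < bdf w := bdf_pos_iff.2 hw
      obtain ⟨n₀, hn₀⟩ := exists_nat_gt (2 / bdf w)
      refine tendsto_const_nhds.congr' ?_
      filter_upwards [eventually_ge_atTop n₀] with n hn
      have h2 : 2 < ((n + N : ℕ) : ℝ) * bdf w := by
        have h1 := (div_lt_iff₀ hdw).1 hn₀
        have h3 : (n₀ : ℝ) ≤ ((n + N : ℕ) : ℝ) := by exact_mod_cast hn.trans (Nat.le_add_right _ _)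
        nlinarith
      simp only [hF, hφ]
      rw [dbar_cutoff_mul_primitive ha hz1 hw hv, deriv_smoothTransition_eq_zero
        (fun h => by linarith [h.2]), cutoff, Real.smoothTransition.one_of_one_le (by linarith)]
      have : w - z ≠ 0 := sub_ne_zero.2 hwz
      simp only [zero_mul, Complex.ofReal_zero, neg_zero, zero_add, Complex.ofReal_one, one_mul, hQ]
      rw [eq_div_iff this]
      ring
  simp only [hFint] at hlim
  have h := tendsto_nhds_unique hlim tendsto_const_nhds
  rw [integral_neg, integral_const_mul, neg_inj] at h
  have hpi : (Real.pi : ℂ) ≠ 0 := by exact_mod_cast Real.pi_ne_zero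
  rw [integral_diskMeasure, eq_div_iff (by simp)]
  apply mul_left_cancel₀ hpi
  linear_combination h

/-! ### Pairings of Fourier modes with the kernel -/

/-- The pairing of a function on the circle bundle with `v^n` times the kernel. -/
def modePairing (γ : ℝ) (n : ℕ) (z : ℂ) (Φ : ℂ × ℂ → ℂ) : ℂ :=
  ∫ x, Φ x * conj (x.2 ^ n * bundleKernel γ z x) ∂((diskMeasure γ).prod dirMeasure)

lemma ae_dirMeasure : ∀ᵐ v ∂dirMeasure, ‖v‖ = 1 := by
  rw [dirMeasure, ae_map_iff measurable_expI.aemeasurable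
    (measurableSet_eq_fun measurable_norm measurable_const)]
  exact ae_of_all _ norm_expI

lemma ae_bundle (γ : ℝ) : ∀ᵐ x ∂((diskMeasure γ).prod dirMeasure),
    x.1 ∈ Metric.ball (0 : ℂ) 1 ∧ ‖x.2‖ = 1 :=
  (Measure.quasiMeasurePreserving_fst.ae (ae_mem_ball γ)).and
    (Measure.quasiMeasurePreserving_snd.ae ae_dirMeasure)

/-- The mean value property on the unit circle, whose total length is `2π`. -/
lemma integral_dirMeasure_of_differentiableOn {f : ℂ → ℂ} (hm : Measurable f)
    (hf : ∀ v, ‖v‖ ≤ 1 → DifferentiableAt ℂ f v) :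
    ∫ v, f v ∂dirMeasure = 2 * Real.pi * f 0 := by
  have h1 : DiffContOnCl ℂ f (Metric.ball 0 |1|) := by
    refine DifferentiableOn.diffContOnCl fun v hv => (hf v ?_).differentiableWithinAt
    have := Metric.closure_ball_subset_closedBall hv
    simpa using this
  have h2 := h1.circleAverage
  rw [Real.circleAverage, inv_smul_eq_iff₀ (by positivity),
    intervalIntegral.integral_of_le Real.two_pi_pos.le] at h2
  rw [dirMeasure, integral_map measurable_expI.aemeasurable hm.aestronglyMeasurable]
  have h3 : ∀ θ : ℝ, Complex.exp (Complex.I * θ) = circleMap 0 1 θ := fun θ => by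
    rw [circleMap, mul_comm]; simp
  simp only [h3, h2, Complex.real_smul]
  push_cast; ring

lemma integral_pow_mul_conj_pow (m n : ℕ) :
    ∫ v, v ^ m * conj (v ^ n) ∂dirMeasure = if m = n then 2 * (Real.pi : ℂ) else 0 := by
  have key : ∀ k : ℕ, ∫ v, v ^ k ∂dirMeasure = 2 * Real.pi * 0 ^ k := fun k =>
    integral_dirMeasure_of_differentiableOn (f := fun v => v ^ k) (by fun_prop)
      fun v _ => by fun_prop
  have hmul : ∀ (v : ℂ) (k : ℕ), ‖v‖ = 1 → v ^ k * conj (v ^ k) = 1 := fun v k hv => by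
    rw [Complex.mul_conj, Complex.normSq_eq_norm_sq, norm_pow, hv]; simp
  rcases le_total n m with h | h
  · obtain ⟨k, rfl⟩ := Nat.exists_eq_add_of_le h
    have : ∫ v, v ^ (n + k) * conj (v ^ n) ∂dirMeasure = ∫ v, v ^ k ∂dirMeasure := by
      refine integral_congr_ae ?_
      filter_upwards [ae_dirMeasure] with v hv
      rw [pow_add, mul_right_comm, hmul v n hv, one_mul]
    rw [this, key]
    rcases eq_or_ne k 0 with rfl | hk
    · simp
    · simp [hk]
  · obtain ⟨k, rfl⟩ := Nat.exists_eq_add_of_le h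
    have : ∫ v, v ^ m * conj (v ^ (m + k)) ∂dirMeasure = conj (∫ v, v ^ k ∂dirMeasure) := by
      rw [← integral_conj]
      refine integral_congr_ae ?_
      filter_upwards [ae_dirMeasure] with v hv
      rw [pow_add, map_mul, ← mul_assoc, hmul v m hv, one_mul]
    rw [this, key]
    rcases eq_or_ne k 0 with rfl | hk
    · simp [map_ofNat]
    · simp [hk]

lemma differentiableAt_bundleKernel_dir (γ : ℝ) {z w v : ℂ} (hz : ‖z‖ < 1) (hw : ‖w‖ ≤ 1)
    (hv : ‖v‖ ≤ 1) : DifferentiableAt ℂ (fun v => bundleKernel γ z (w, v)) v := by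
  have hB := kernelBase_mem_slitPlane hz hw hv
  have h1 : DifferentiableAt ℂ (fun v => kernelBase z w v) v := by
    unfold kernelBase; fun_prop
  have h2 : DifferentiableAt ℂ (fun v => kernelBase z w v ^ ((γ : ℂ) + 2)) v :=
    h1.cpow (differentiableAt_const _) hB
  unfold bundleKernel
  refine DifferentiableAt.div (by fun_prop) h2 ?_
  rw [Complex.cpow_ne_zero_iff]
  exact Or.inl (Complex.slitPlane_ne_zero hB)

/-- The kernel has no negative Fourier modes in the direction, as it extends analytically to the
directions inside the unit circle. -/
lemma integral_dir_bundleKernel (γ : ℝ) (k : ℕ) {z w : ℂ} (hz : ‖z‖ < 1) (hw : ‖w‖ ≤ 1) :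
    ∫ v, v ^ k * bundleKernel γ z (w, v) ∂dirMeasure
      = 2 * Real.pi * (0 ^ k * bundleKernel γ z (w, 0)) := by
  refine integral_dirMeasure_of_differentiableOn
    (f := fun v => v ^ k * bundleKernel γ z (w, v)) ?_ fun v hv => ?_
  · exact (measurable_id.pow_const k).mul
      ((measurable_bundleKernel γ z).comp measurable_prodMk_left)
  · exact DifferentiableAt.mul (by fun_prop) (differentiableAt_bundleKernel_dir γ hz hw hv)

lemma measurable_mode (γ : ℝ) (n : ℕ) (z : ℂ) :
    Measurable fun x : ℂ × ℂ => conj (x.2 ^ n * bundleKernel γ z x) :=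
  Complex.continuous_conj.measurable.comp
    ((measurable_snd.pow_const n).mul (measurable_bundleKernel γ z))

lemma integrable_mul_mode {γ : ℝ} (hγ : -1 < γ) (n : ℕ) {z : ℂ} (hz : ‖z‖ < 1) {Φ : ℂ × ℂ → ℂ}
    (hΦ : Integrable Φ ((diskMeasure γ).prod dirMeasure)) :
    Integrable (fun x => Φ x * conj (x.2 ^ n * bundleKernel γ z x))
      ((diskMeasure γ).prod dirMeasure) := by
  refine hΦ.mul_bdd (c := kernelBound γ z) (measurable_mode γ n z).aestronglyMeasurable ?_
  filter_upwards [ae_bundle γ] with x hx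
  rw [Complex.norm_conj, norm_mul, norm_pow, hx.2, one_pow, one_mul]
  exact norm_bundleKernel_le hγ hz (mem_ball_zero_iff.1 hx.1).le hx.2.le

lemma integrable_of_memLp {γ : ℝ} (hγ : -1 < γ) {Φ : ℂ × ℂ → ℂ}
    (hΦ : MemLp Φ 2 ((diskMeasure γ).prod dirMeasure)) :
    Integrable Φ ((diskMeasure γ).prod dirMeasure) := by
  have := isFiniteMeasure_diskMeasure hγ
  exact hΦ.integrable one_le_two

lemma modePairing_add {γ : ℝ} (hγ : -1 < γ) (n : ℕ) {z : ℂ} (hz : ‖z‖ < 1) {Φ Ψ : ℂ × ℂ → ℂ}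
    (hΦ : MemLp Φ 2 ((diskMeasure γ).prod dirMeasure))
    (hΨ : MemLp Ψ 2 ((diskMeasure γ).prod dirMeasure)) :
    modePairing γ n z (fun x => Φ x + Ψ x) = modePairing γ n z Φ + modePairing γ n z Ψ := by
  rw [modePairing, modePairing, modePairing,
    ← integral_add (integrable_mul_mode hγ n hz (integrable_of_memLp hγ hΦ))
      (integrable_mul_mode hγ n hz (integrable_of_memLp hγ hΨ))]
  simp only [add_mul]

lemma modePairing_sum {γ : ℝ} (hγ : -1 < γ) (n : ℕ) {z : ℂ} (hz : ‖z‖ < 1) {ι : Type*}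
    (s : Finset ι) {Φ : ι → ℂ × ℂ → ℂ}
    (hΦ : ∀ i ∈ s, MemLp (Φ i) 2 ((diskMeasure γ).prod dirMeasure)) :
    modePairing γ n z (fun x => ∑ i ∈ s, Φ i x) = ∑ i ∈ s, modePairing γ n z (Φ i) := by
  simp only [modePairing]
  rw [← integral_finsetSum _ fun i hi =>
    integrable_mul_mode hγ n hz (integrable_of_memLp hγ (hΦ i hi))]
  simp only [Finset.sum_mul]

/-- The product of a function of the point in `L²(d^γ)` with a unimodular function of the direction
is square integrable. -/
lemma memLp_mul_dir {γ : ℝ} {g : ℂ → ℂ} (hg : MemLp g 2 (diskMeasure γ)) {p : ℂ → ℂ}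
    (hp : Measurable p) (hp1 : ∀ v, ‖v‖ = 1 → ‖p v‖ = 1) :
    MemLp (fun x : ℂ × ℂ => g x.1 * p x.2) 2 ((diskMeasure γ).prod dirMeasure) := by
  have h := hg.comp_fst dirMeasure
  refine h.congr_norm (h.1.mul (hp.comp measurable_snd).aestronglyMeasurable) ?_
  filter_upwards [ae_bundle γ] with x hx
  rw [norm_mul, hp1 _ hx.2, mul_one]

lemma memLp_mul_pow {γ : ℝ} {g : ℂ → ℂ} (hg : MemLp g 2 (diskMeasure γ)) (m : ℕ) :
    MemLp (fun x : ℂ × ℂ => g x.1 * x.2 ^ m) 2 ((diskMeasure γ).prod dirMeasure) :=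
  memLp_mul_dir hg (p := fun v => v ^ m) (by fun_prop) fun v hv => by rw [norm_pow, hv, one_pow]

lemma memLp_mul_conj_pow {γ : ℝ} {g : ℂ → ℂ} (hg : MemLp g 2 (diskMeasure γ)) (m : ℕ) :
    MemLp (fun x : ℂ × ℂ => g x.1 * conj x.2 ^ m) 2 ((diskMeasure γ).prod dirMeasure) :=
  memLp_mul_dir hg (p := fun v => conj v ^ m)
    (Complex.continuous_conj.measurable.pow_const m)
    fun v hv => by rw [norm_pow, Complex.norm_conj, hv, one_pow]

/-- The kernel of mode `n` reproduces analytic functions of mode `n` and annihilates analytic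
functions of the other nonnegative modes. -/
theorem modePairing_analytic {γ : ℝ} (hγ : -1 < γ) (m n : ℕ) {a : ℂ → ℂ}
    (ha : DifferentiableOn ℂ a (Metric.ball 0 1)) (hi : MemLp a 2 (diskMeasure γ))
    {z : ℂ} (hz : z ∈ Metric.ball (0 : ℂ) 1) :
    modePairing γ n z (fun x => a x.1 * x.2 ^ m) = if m = n then a z else 0 := by
  have hfin := isFiniteMeasure_diskMeasure hγ
  have hz1 := mem_ball_zero_iff.1 hz
  have hint := integrable_mul_mode hγ n hz1 (integrable_of_memLp hγ (memLp_mul_pow hi m))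
  rw [modePairing, integral_prod_symm _ hint]
  have hpi : (Real.pi : ℂ) ≠ 0 := by exact_mod_cast Real.pi_ne_zero
  have : ∫ v, ∫ w, a w * v ^ m * conj (v ^ n * bundleKernel γ z (w, v)) ∂(diskMeasure γ)
      ∂dirMeasure = ∫ v, v ^ m * conj (v ^ n) * (a z / (2 * Real.pi)) ∂dirMeasure := by
    refine integral_congr_ae ?_
    filter_upwards [ae_dirMeasure] with v hv
    rw [← integral_mul_conj_bundleKernel hγ ha (hi.integrable one_le_two) hz hv.le,
      ← integral_const_mul]
    congr 1 with w
    rw [map_mul]; ring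
  rw [this, integral_mul_const, integral_pow_mul_conj_pow]
  split_ifs
  · field_simp
  · simp

/-- The pairing with a function of the form `g(w) p(v)` where the angular factor `p` times `v̄^n`
is `v̄^k`. -/
lemma modePairing_of_dir {γ : ℝ} (hγ : -1 < γ) {n k : ℕ} {g p : ℂ → ℂ}
    (hg : MemLp g 2 (diskMeasure γ)) (hp : Measurable p) (hp1 : ∀ v, ‖v‖ = 1 → ‖p v‖ = 1)
    (hpk : ∀ v, ‖v‖ = 1 → p v * conj (v ^ n) = conj (v ^ k)) {z : ℂ} (hz : ‖z‖ < 1) :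
    modePairing γ n z (fun x => g x.1 * p x.2)
      = 2 * Real.pi * 0 ^ k * ∫ w, g w * conj (bundleKernel γ z (w, 0)) ∂(diskMeasure γ) := by
  have hint := integrable_mul_mode hγ n hz (integrable_of_memLp hγ (memLp_mul_dir hg hp hp1))
  rw [modePairing, integral_prod _ hint, ← integral_const_mul]
  refine integral_congr_ae ?_
  filter_upwards [ae_mem_ball γ] with w hw
  have h1 : ∫ v, g w * p v * conj (v ^ n * bundleKernel γ z (w, v)) ∂dirMeasure
      = g w * conj (∫ v, v ^ k * bundleKernel γ z (w, v) ∂dirMeasure) := by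
    rw [← integral_conj, ← integral_const_mul]
    refine integral_congr_ae ?_
    filter_upwards [ae_dirMeasure] with v hv
    rw [map_mul, map_mul, ← hpk v hv]; ring
  refine h1.trans ?_
  rw [integral_dir_bundleKernel γ k hz (mem_ball_zero_iff.1 hw).le]
  simp only [map_mul, map_pow, map_zero, Complex.conj_ofReal, map_ofNat]
  ring

/-- The kernel of mode `n` annihilates the modes `g v̄^m`, whether `g` is analytic or not, unless
`m = n = 0`. -/
lemma modePairing_conj_pow {γ : ℝ} (hγ : -1 < γ) {m n : ℕ} (hmn : 1 ≤ m + n) {g : ℂ → ℂ}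
    (hg : MemLp g 2 (diskMeasure γ)) {z : ℂ} (hz : ‖z‖ < 1) :
    modePairing γ n z (fun x => g x.1 * conj x.2 ^ m) = 0 := by
  rw [modePairing_of_dir (p := fun v => conj v ^ m) (k := m + n) hγ hg
    (Complex.continuous_conj.measurable.pow_const m)
    (fun v hv => by rw [norm_pow, Complex.norm_conj, hv, one_pow])
    (fun v _ => by rw [map_pow, map_pow, pow_add]) hz]
  rw [zero_pow (by omega)]; ring

/-! ### The potential part of odd fields -/

/-- The coefficient of `dw` in a real-linear form `L = a dw + b dw̄`. -/
def dhol (L : ℂ →L[ℝ] ℂ) : ℂ := (L 1 - Complex.I * L Complex.I) / 2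

lemma apply_eq_dhol_dbar (L : ℂ →L[ℝ] ℂ) (v : ℂ) : L v = dhol L * v + dbar L * conj v := by
  have h1 : v = v.re • (1 : ℂ) + v.im • Complex.I := by
    apply Complex.ext <;> simp
  have h2 : (v.re : ℂ) + v.im * Complex.I = v := Complex.re_add_im v
  have h3 : (v.re : ℂ) - v.im * Complex.I = conj v := by
    apply Complex.ext <;> simp
  conv_lhs => rw [h1]
  rw [map_add, map_smul, map_smul, Complex.real_smul, Complex.real_smul, ← h3, dhol, dbar]
  linear_combination ((L 1 - Complex.I * L Complex.I) / 2) * h2 + (v.im * L Complex.I) * Complex.I_sq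

lemma norm_dhol_le (L : ℂ →L[ℝ] ℂ) : ‖dhol L‖ ≤ ‖L‖ := by
  have h1 := L.le_opNorm 1
  have h2 := L.le_opNorm Complex.I
  rw [norm_one, mul_one] at h1
  rw [Complex.norm_I, mul_one] at h2
  rw [dhol, norm_div, Complex.norm_ofNat, div_le_iff₀ two_pos]
  refine (norm_sub_le _ _).trans ?_
  rw [norm_mul, Complex.norm_I, one_mul]
  linarith

lemma norm_dbar_le (L : ℂ →L[ℝ] ℂ) : ‖dbar L‖ ≤ ‖L‖ := by
  have h1 := L.le_opNorm 1
  have h2 := L.le_opNorm Complex.I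
  rw [norm_one, mul_one] at h1
  rw [Complex.norm_I, mul_one] at h2
  rw [dbar, norm_div, Complex.norm_ofNat, div_le_iff₀ two_pos]
  refine (norm_add_le _ _).trans ?_
  rw [norm_mul, Complex.norm_I, one_mul]
  linarith

lemma continuous_dhol : Continuous dhol := by
  unfold dhol; fun_prop

lemma continuous_dbar : Continuous dbar := by
  unfold dbar; fun_prop

/-- The derivative `∂/∂w̄` of a compactly supported function has integral zero: this is the
Cauchy–Pompeiu formula for `w φ` at the origin. -/
lemma integral_dbar {φ : ℂ → ℂ} (hφ : ContDiff ℝ 1 φ) (hc : HasCompactSupport φ) :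
    ∫ w, dbar (fderiv ℝ φ w) = 0 := by
  have h := integral_dbar_div (φ := fun w => w * φ w) (contDiff_id.mul hφ) hc.mul_left 0
  rw [zero_mul, mul_zero, neg_zero] at h
  rw [← h]
  refine integral_congr_ae ?_
  have hne : ∀ᵐ w : ℂ, w ≠ 0 := by simp [ae_iff]
  filter_upwards [hne] with w hw
  have h1 : HasDbarAt (fun w => w) 0 w := hasDbarAt_of_differentiableAt differentiableAt_id
  have h2 : HasDbarAt φ (dbar (fderiv ℝ φ w)) w :=
    ⟨_, (hφ.differentiable one_ne_zero w).hasFDerivAt, rfl⟩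
  rw [(h1.mul h2).dbar_fderiv, sub_zero, zero_mul, zero_add, mul_div_cancel_left₀ _ hw]

lemma hasFDerivAt_conj_comp {u : ℂ → ℂ} {w : ℂ} (hu : DifferentiableAt ℝ u w) :
    HasFDerivAt (fun w => conj (u w)) ((Complex.conjCLE : ℂ →L[ℝ] ℂ).comp (fderiv ℝ u w)) w :=
  Complex.conjCLE.hasFDerivAt.comp w hu.hasFDerivAt

lemma dbar_conj_comp (L : ℂ →L[ℝ] ℂ) :
    dbar ((Complex.conjCLE : ℂ →L[ℝ] ℂ).comp L) = conj (dhol L) := by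
  simp [dbar, dhol, map_ofNat]

/-- The derivatives `∂/∂w` of test functions are orthogonal to analytic functions. -/
lemma integral_dhol_mul_conj_eq_zero {u g : ℂ → ℂ} (hu : ContDiff ℝ 1 u)
    (hs : tsupport u ⊆ Metric.ball (0 : ℂ) 1)
    (hg : DifferentiableOn ℂ g (Metric.ball 0 1)) :
    ∫ w in Metric.ball (0 : ℂ) 1, dhol (fderiv ℝ u w) * conj (g w) = 0 := by
  -- Up to conjugation the integrand is the `∂/∂w̄` derivative of `ū g`.
  set φ : ℂ → ℂ := fun w => conj (u w) * g w with hφ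
  have hud : Differentiable ℝ u := hu.differentiable one_ne_zero
  have hzero : ∀ w ∉ Metric.ball (0 : ℂ) 1, φ =ᶠ[𝓝 w] fun _ => 0 := fun w hw => by
    have h1 : u =ᶠ[𝓝 w] fun _ => 0 := notMem_tsupport_iff_eventuallyEq.1 fun h => hw (hs h)
    filter_upwards [h1] with y hy
    simp [hφ, hy]
  have hφ1 : ContDiff ℝ 1 φ := by
    rw [contDiff_iff_contDiffAt]
    intro w
    by_cases hw : w ∈ Metric.ball (0 : ℂ) 1
    · have h1 : ContDiffAt ℝ 1 g w := ((hg.contDiffOn (n := 1) Metric.isOpen_ball).contDiffAt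
        (Metric.isOpen_ball.mem_nhds hw)).restrict_scalars ℝ
      exact (Complex.conjCLE.contDiff.comp hu).contDiffAt.mul h1
    · exact contDiffAt_const.congr_of_eventuallyEq (hzero w hw)
  have hφc : HasCompactSupport φ := by
    refine HasCompactSupport.intro (isCompact_closedBall (0 : ℂ) 1) fun w hw => ?_
    exact (hzero w fun h => hw (Metric.ball_subset_closedBall h)).self_of_nhds
  have h := integral_dbar hφ1 hφc
  rw [← setIntegral_eq_integral_of_forall_compl_eq_zero (s := Metric.ball (0 : ℂ) 1)] at h
  · have h2 : ∫ w in Metric.ball (0 : ℂ) 1, dbar (fderiv ℝ φ w)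
        = conj (∫ w in Metric.ball (0 : ℂ) 1, dhol (fderiv ℝ u w) * conj (g w)) := by
      rw [← integral_conj]
      refine setIntegral_congr_fun measurableSet_ball fun w hw => ?_
      have h3 : HasDbarAt (fun w => conj (u w)) (conj (dhol (fderiv ℝ u w))) w :=
        ⟨_, hasFDerivAt_conj_comp (hud w), dbar_conj_comp _⟩
      have h4 := hasDbarAt_of_differentiableAt
        (hg.differentiableAt (Metric.isOpen_ball.mem_nhds hw))
      simp only [hφ]
      rw [(h3.mul h4).dbar_fderiv, map_mul, Complex.conj_conj]
      ring
    rw [h2] at h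
    simpa using h
  · intro w hw
    rw [(hzero w hw).fderiv_eq]
    simp [dbar]

lemma diskMeasure_ac (γ δ : ℝ) : diskMeasure γ ≪ diskMeasure δ :=
  Measure.ae_le_iff_absolutelyContinuous.1 fun _ h =>
    (ae_diskMeasure_iff γ).2 ((ae_diskMeasure_iff δ).1 h)

section Weight
variable {E : Type*} [NormedAddCommGroup E] [NormedSpace ℝ E]

/-- Multiplication by `d^{-γ}` is an isometry from `L²(d^{-γ})` to `L²(d^γ)`. -/
lemma eLpNorm_weight_smul (γ : ℝ) (f : ℂ → E) :
    eLpNorm (fun w => bdf w ^ (-γ) • f w) 2 (diskMeasure γ) = eLpNorm f 2 (diskMeasure (-γ)) := by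
  rw [eLpNorm_eq_lintegral_rpow_enorm_toReal two_ne_zero ENNReal.ofNat_ne_top,
    eLpNorm_eq_lintegral_rpow_enorm_toReal two_ne_zero ENNReal.ofNat_ne_top]
  congr 1
  simp only [ENNReal.toReal_ofNat]
  have hm : ∀ δ : ℝ, Measurable fun w => ENNReal.ofReal (bdf w ^ δ) := fun δ =>
    (measurable_bdf.pow_const δ).ennreal_ofReal
  rw [diskMeasure, diskMeasure, lintegral_withDensity_eq_lintegral_mul_non_measurable _ (hm γ)
      (ae_of_all _ fun _ => ENNReal.ofReal_lt_top),
    lintegral_withDensity_eq_lintegral_mul_non_measurable _ (hm (-γ))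
      (ae_of_all _ fun _ => ENNReal.ofReal_lt_top)]
  refine setLIntegral_congr_fun measurableSet_ball fun w hw => ?_
  have hd : 0 < bdf w := bdf_pos_iff.2 hw
  have hp : 0 < bdf w ^ (-γ) := Real.rpow_pos_of_pos hd _
  simp only [Pi.mul_apply]
  rw [enorm_smul, ENNReal.mul_rpow_of_nonneg _ _ zero_le_two, ← ofReal_norm (bdf w ^ (-γ)),
    Real.norm_of_nonneg hp.le, ENNReal.ofReal_rpow_of_nonneg hp.le zero_le_two, ← mul_assoc,
    ← ENNReal.ofReal_mul (by positivity), ← Real.rpow_mul hd.le, ← Real.rpow_add hd]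
  congr 3; ring

lemma memLp_weight_smul {γ : ℝ} {f : ℂ → E} (hf : MemLp f 2 (diskMeasure (-γ))) :
    MemLp (fun w => bdf w ^ (-γ) • f w) 2 (diskMeasure γ) := by
  refine ⟨?_, by rw [eLpNorm_weight_smul]; exact hf.2⟩
  exact (measurable_bdf.pow_const _).aestronglyMeasurable.smul
    (hf.1.mono_ac (diskMeasure_ac γ (-γ)))

end Weight

/-- The `∂/∂w` derivative of an element of the weighted Sobolev space is orthogonal to bounded
analytic functions. -/
lemma integral_dhol_isH01 {γ : ℝ} (hγ : -1 < γ) {h : ℂ → ℂ} {dh : ℂ → ℂ →L[ℝ] ℂ}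
    (hh : IsH01 (-γ) h dh) {g : ℂ → ℂ} (hg : DifferentiableOn ℂ g (Metric.ball 0 1))
    (hgm : Measurable g) {C : ℝ} (hC : ∀ w ∈ Metric.ball (0 : ℂ) 1, ‖g w‖ ≤ C) :
    ∫ w, dhol (bdf w ^ (-γ) • dh w) * conj (g w) ∂(diskMeasure γ) = 0 := by
  have hfin := isFiniteMeasure_diskMeasure hγ
  obtain ⟨-, hdh, u, hu, -, hlim⟩ := hh
  have hgC : AEStronglyMeasurable (fun w => conj (g w)) (diskMeasure γ) :=
    (Complex.continuous_conj.measurable.comp hgm).aestronglyMeasurable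
  have hgb : ∀ᵐ w ∂(diskMeasure γ), ‖conj (g w)‖ ≤ C := by
    filter_upwards [ae_mem_ball γ] with w hw
    rw [Complex.norm_conj]; exact hC w hw
  have hDm := memLp_weight_smul hdh
  have hC0 : 0 ≤ C := (norm_nonneg _).trans (hC 0 (by simp))
  have hsmul : ∀ (c : ℝ) (L : ℂ →L[ℝ] ℂ), dhol (c • L) = c * dhol L := fun c L => by
    simp [dhol]; ring
  have hint : ∀ {D : ℂ → ℂ →L[ℝ] ℂ}, MemLp D 2 (diskMeasure γ) →
      Integrable (fun w => dhol (D w) * conj (g w)) (diskMeasure γ) := fun {D} hD =>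
    (Integrable.mono (hD.integrable one_le_two) (continuous_dhol.comp_aestronglyMeasurable hD.1)
      (ae_of_all _ fun w => norm_dhol_le _)).mul_bdd hgC hgb
  have hdm : ∀ n, AEStronglyMeasurable (fun w => fderiv ℝ (u n) w) (diskMeasure (-γ)) := fun n =>
    ((hu n).1.continuous_fderiv (by simp)).aestronglyMeasurable
  have hev : ∀ᶠ n in atTop, MemLp (fun w => fderiv ℝ (u n) w) 2 (diskMeasure (-γ)) := by
    filter_upwards [hlim.eventually (gt_mem_nhds ENNReal.zero_lt_top)] with n hn
    have h1 : MemLp (fun w => fderiv ℝ (u n) w - dh w) 2 (diskMeasure (-γ)) :=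
      ⟨(hdm n).sub hdh.1, hn⟩
    exact (h1.add hdh).ae_eq (ae_of_all _ fun w => by simp)
  -- Convergence of the test functions in `L²` implies convergence of the pairings in `L¹`, the
  -- measure `d^γ dx dy` being finite.
  have hL1 : Tendsto (fun n => ∫⁻ w, ‖dhol (bdf w ^ (-γ) • fderiv ℝ (u n) w) * conj (g w)
      - dhol (bdf w ^ (-γ) • dh w) * conj (g w)‖ₑ ∂(diskMeasure γ)) atTop (𝓝 0) := by
    have hK : ENNReal.ofReal C * (diskMeasure γ) Set.univ
        ^ (1 / (1 : ENNReal).toReal - 1 / (2 : ENNReal).toReal) ≠ ⊤ := by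
      refine ENNReal.mul_ne_top ENNReal.ofReal_ne_top (ENNReal.rpow_ne_top_of_nonneg ?_
        (measure_ne_top _ _))
      norm_num
    have h0 := ENNReal.Tendsto.const_mul hlim (Or.inr hK)
    rw [mul_zero] at h0
    refine tendsto_of_tendsto_of_tendsto_of_le_of_le tendsto_const_nhds h0 (fun _ => zero_le)
      fun n => ?_
    have h1 : AEStronglyMeasurable (fun w => bdf w ^ (-γ) • (fderiv ℝ (u n) w - dh w))
        (diskMeasure γ) :=
      (measurable_bdf.pow_const _).aestronglyMeasurable.smul
        (((hdm n).sub hdh.1).mono_ac (diskMeasure_ac γ (-γ)))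
    have h2 := eLpNorm_le_eLpNorm_mul_rpow_measure_univ (p := 1) (q := 2) one_le_two h1
    rw [eLpNorm_weight_smul, eLpNorm_one_eq_lintegral_enorm] at h2
    calc _ ≤ ∫⁻ w, ENNReal.ofReal C * ‖bdf w ^ (-γ) • (fderiv ℝ (u n) w - dh w)‖ₑ
          ∂(diskMeasure γ) := by
          refine lintegral_mono_ae ?_
          filter_upwards [hgb] with w hw
          have h3 : dhol (bdf w ^ (-γ) • fderiv ℝ (u n) w) * conj (g w)
              - dhol (bdf w ^ (-γ) • dh w) * conj (g w)
              = conj (g w) * dhol (bdf w ^ (-γ) • (fderiv ℝ (u n) w - dh w)) := by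
            rw [hsmul, hsmul, hsmul, dhol, dhol, dhol, sub_apply,
              sub_apply]
            ring
          rw [h3, enorm_mul, ← ofReal_norm (conj (g w)), ← ofReal_norm (dhol _), ← ofReal_norm]
          exact mul_le_mul' (ENNReal.ofReal_le_ofReal hw)
            (ENNReal.ofReal_le_ofReal (norm_dhol_le _))
      _ = ENNReal.ofReal C * ∫⁻ w, ‖bdf w ^ (-γ) • (fderiv ℝ (u n) w - dh w)‖ₑ
          ∂(diskMeasure γ) := lintegral_const_mul' _ _ ENNReal.ofReal_ne_top
      _ ≤ _ := by
          refine (mul_le_mul_right h2 _).trans (le_of_eq ?_)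
          ring
  have ht := tendsto_integral_of_L1 _ (hint hDm).1
    (hev.mono fun n hn => hint (memLp_weight_smul hn)) hL1
  refine tendsto_nhds_unique ht ((tendsto_congr fun n => ?_).2 tendsto_const_nhds)
  rw [integral_diskMeasure]
  refine Eq.trans ?_ (integral_dhol_mul_conj_eq_zero ((hu n).1.of_le (by simp)) (hu n).2.2 hg)
  refine setIntegral_congr_fun measurableSet_ball fun w hw => ?_
  have hd : 0 < bdf w := bdf_pos_iff.2 hw
  have h1 : ((bdf w ^ (-γ) : ℝ) : ℂ) * ((bdf w ^ γ : ℝ) : ℂ) = 1 := by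
    rw [← Complex.ofReal_mul, ← Real.rpow_add hd, neg_add_cancel, Real.rpow_zero,
      Complex.ofReal_one]
  simp only [hsmul]
  linear_combination (dhol (fderiv ℝ (u n) w) * conj (g w)) * h1

/-- The value on `-i v` of the weighted differential, that is `d^{-γ} ⋆dh`, as a function on the
circle bundle. -/
def potential (γ : ℝ) (dh : ℂ → ℂ →L[ℝ] ℂ) (x : ℂ × ℂ) : ℂ :=
  ((bdf x.1 ^ (-γ) : ℝ) : ℂ) * dh x.1 (-Complex.I * x.2)

lemma potential_eq (γ : ℝ) (dh : ℂ → ℂ →L[ℝ] ℂ) (x : ℂ × ℂ) :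
    potential γ dh x = (-Complex.I * dhol (bdf x.1 ^ (-γ) • dh x.1)) * x.2 ^ 1
      + (Complex.I * dbar (bdf x.1 ^ (-γ) • dh x.1)) * conj x.2 ^ 1 := by
  rw [potential, ← Complex.real_smul, ← smul_apply, apply_eq_dhol_dbar]
  simp
  ring

lemma memLp_dhol_dbar {γ : ℝ} {D : ℂ → ℂ →L[ℝ] ℂ} (hD : MemLp D 2 (diskMeasure γ)) :
    MemLp (fun w => -Complex.I * dhol (D w)) 2 (diskMeasure γ) ∧
    MemLp (fun w => Complex.I * dbar (D w)) 2 (diskMeasure γ) :=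
  ⟨(hD.of_le (continuous_dhol.comp_aestronglyMeasurable hD.1)
      (ae_of_all _ fun _ => norm_dhol_le _)).const_mul _,
    (hD.of_le (continuous_dbar.comp_aestronglyMeasurable hD.1)
      (ae_of_all _ fun _ => norm_dbar_le _)).const_mul _⟩

lemma memLp_potential {γ : ℝ} {h : ℂ → ℂ} {dh : ℂ → ℂ →L[ℝ] ℂ} (hh : IsH01 (-γ) h dh) :
    MemLp (potential γ dh) 2 ((diskMeasure γ).prod dirMeasure) := by
  have hD := memLp_dhol_dbar (memLp_weight_smul hh.2.1)
  have : potential γ dh = fun x => _ := funext (potential_eq γ dh)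
  rw [this]
  exact (memLp_mul_pow hD.1 1).add (memLp_mul_conj_pow hD.2 1)

/-- The kernel annihilates the potential part: the `v̄` component by the Fourier modes in the
direction, the `v` component because averaging over the directions leaves, for `j = 0`, the pairing
of `∂h/∂w` with a bounded analytic function. -/
lemma modePairing_potential {γ : ℝ} (hγ : -1 < γ) {h : ℂ → ℂ} {dh : ℂ → ℂ →L[ℝ] ℂ}
    (hh : IsH01 (-γ) h dh) (j : ℕ) {z : ℂ} (hz : ‖z‖ < 1) :
    modePairing γ (2 * j + 1) z (potential γ dh) = 0 := by
  have hD := memLp_dhol_dbar (memLp_weight_smul hh.2.1)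
  have : potential γ dh = fun x => _ := funext (potential_eq γ dh)
  rw [this, modePairing_add hγ _ hz (memLp_mul_pow hD.1 1) (memLp_mul_conj_pow hD.2 1),
    modePairing_conj_pow hγ (by omega) hD.2 hz, add_zero,
    modePairing_of_dir (p := fun v => v ^ 1) (k := 2 * j) hγ hD.1 (by fun_prop)
      (fun v hv => by rw [norm_pow, hv, one_pow]) (fun v hv => ?_) hz]
  · have hgd : DifferentiableOn ℂ (fun w => bundleKernel γ z (w, 0)) (Metric.ball 0 1) := by
      intro w hw
      have hB := kernelBase_mem_slitPlane (v := 0) hz (mem_ball_zero_iff.1 hw).le (by simp)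
      refine DifferentiableAt.differentiableWithinAt ?_
      simp only [bundleKernel, kernelBase] at hB ⊢
      simp only [ne_eq, OfNat.ofNat_ne_zero, not_false_eq_true, zero_pow, zero_mul, add_zero]
        at hB ⊢
      refine DifferentiableAt.div (by fun_prop) (DifferentiableAt.cpow (by fun_prop)
        (by fun_prop) hB) ?_
      rw [Complex.cpow_ne_zero_iff]
      exact Or.inl (Complex.slitPlane_ne_zero hB)
    have h0 := integral_dhol_isH01 hγ hh hgd
      ((measurable_bundleKernel γ z).comp measurable_prodMk_right) (C := kernelBound γ z)
      fun w hw => norm_bundleKernel_le hγ hz (mem_ball_zero_iff.1 hw).le (by simp)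
    simp only [mul_assoc]
    rw [integral_const_mul, h0]
    simp
  · have h1 : v * conj v = 1 := by
      rw [Complex.mul_conj, Complex.normSq_eq_norm_sq, hv]; simp
    rw [pow_one, pow_succ, map_mul]
    linear_combination conj (v ^ (2 * j)) * h1

lemma IsH01.conj {s : ℝ} {h : ℂ → ℂ} {dh : ℂ → ℂ →L[ℝ] ℂ} (hh : IsH01 s h dh) :
    IsH01 s (fun w => conj (h w)) fun w => (Complex.conjCLE : ℂ →L[ℝ] ℂ).comp (dh w) := by
  obtain ⟨h1, h2, u, hu, hl1, hl2⟩ := hh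
  have hn : ∀ L : ℂ →L[ℝ] ℂ, ‖(Complex.conjCLE : ℂ →L[ℝ] ℂ).comp L‖ = ‖L‖ := fun L =>
    ContinuousLinearMap.opNorm_ext _ _ fun x => by simp
  refine ⟨?_, ?_, fun n w => conj (u n w), fun n => ⟨?_, ?_, ?_⟩, ?_, ?_⟩
  · exact h1.congr_norm (Complex.continuous_conj.comp_aestronglyMeasurable h1.1)
      (ae_of_all _ fun w => (Complex.norm_conj _).symm)
  · refine h2.congr_norm ?_ (ae_of_all _ fun w => (hn _).symm)
    exact (((ContinuousLinearMap.compL ℝ ℂ ℂ ℂ) (Complex.conjCLE : ℂ →L[ℝ] ℂ)).continuous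
      ).comp_aestronglyMeasurable h2.1
  · exact Complex.conjCLE.contDiff.comp (hu n).1
  · exact (hu n).2.1.comp_left (map_zero _)
  · exact (tsupport_comp_subset (map_zero _) (u n)).trans (hu n).2.2
  · refine hl1.congr fun n => eLpNorm_congr_norm_ae (ae_of_all _ fun w => ?_)
    rw [← map_sub, Complex.norm_conj]
  · refine hl2.congr fun n => eLpNorm_congr_norm_ae (ae_of_all _ fun w => ?_)
    rw [(hasFDerivAt_conj_comp ((hu n).1.differentiable (by simp) w)).fderiv,
      ← ContinuousLinearMap.comp_sub, hn]

lemma conj_potential (γ : ℝ) (dh : ℂ → ℂ →L[ℝ] ℂ) (x : ℂ × ℂ) :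
    conj (potential γ dh x)
      = potential γ (fun w => (Complex.conjCLE : ℂ →L[ℝ] ℂ).comp (dh w)) x := by
  simp [potential]

/-! ### Tensors on equal arguments -/

lemma symmetrize_apply_const {m : ℕ} (T : Tensor m) (v : ℂ) :
    symmetrize T (fun _ => v) = T fun _ => v := by
  have h : (m.factorial : ℝ) ≠ 0 := by exact_mod_cast m.factorial_ne_zero
  simp only [symmetrize, smul_apply, sum_apply,
    MultilinearMap.domDomCongr_apply, Finset.sum_const, Finset.card_univ, Fintype.card_perm,
    Fintype.card_fin]
  rw [← Nat.cast_smul_eq_nsmul ℝ, smul_smul, inv_mul_cancel₀ h, one_smul]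

lemma castOrder_apply_const {m n : ℕ} (h : m = n) (T : Tensor m) (v : ℂ) :
    castOrder h T (fun _ => v) = T fun _ => v := rfl

lemma tmul_apply_const {m n : ℕ} (S : Tensor m) (T : Tensor n) (v : ℂ) :
    tmul S T (fun _ => v) = S (fun _ => v) * T fun _ => v := by
  simp [tmul]

lemma metric_apply_const {v : ℂ} (hv : ‖v‖ = 1) : metric (fun _ => v) = 1 := by
  have h : (conj v * v).re = 1 := by
    rw [mul_comm, Complex.mul_conj, Complex.normSq_eq_norm_sq, hv]; simp
  change (((conj v * v).re : ℝ) : ℂ) = 1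
  rw [h, Complex.ofReal_one]

/-- Raising the order with the metric does not change the values on unit vectors. -/
lemma raise_apply_const {m n : ℕ} (k : ℕ) (h : m + 2 * k = n) (T : Tensor m) {v : ℂ}
    (hv : ‖v‖ = 1) : raise k h T (fun _ => v) = T fun _ => v := by
  have key : ∀ k, symMetricPow T k (fun _ => v) = T fun _ => v := fun k => by
    induction k with
    | zero => rfl
    | succ k ih =>
      exact (symmetrize_apply_const _ v).trans ((tmul_apply_const metric _ v).trans (by
        rw [metric_apply_const hv, one_mul, ih]))
  rw [raise, castOrder_apply_const, key]

lemma dzPow_apply_const (m : ℕ) (v : ℂ) : dzPow m (fun _ => v) = v ^ m := by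
  simp [dzPow, MultilinearMap.mkPiAlgebra_apply]

lemma dzbarPow_apply_const (m : ℕ) (v : ℂ) : dzbarPow m (fun _ => v) = conj v ^ m := by
  rw [dzbarPow, MultilinearMap.compLinearMap_apply]
  exact dzPow_apply_const m (conj v)

lemma hodge_apply_const (η : ℂ →L[ℝ] ℂ) (v : ℂ) :
    hodge η (fun _ => v) = η (-Complex.I * v) := rfl

/-! ### Reconstruction -/

/-- A tensor field as a function of a point and a direction. -/
def evalField {m : ℕ} (f : TensorField m) (x : ℂ × ℂ) : ℂ := f x.1 fun _ => x.2

lemma xray_eq_bundleXray (γ : ℝ) {m : ℕ} (f : TensorField m) :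
    xray γ f = bundleXray γ (evalField f) := rfl

/-- The function `a v^m + b v̄^m` on the circle bundle. -/
def ttFun (a b : ℂ → ℂ) (m : ℕ) (x : ℂ × ℂ) : ℂ := a x.1 * x.2 ^ m + b x.1 * conj x.2 ^ m

lemma memLp_ttFun {γ : ℝ} {a b : ℂ → ℂ} (ha : MemLp a 2 (diskMeasure γ))
    (hb : MemLp b 2 (diskMeasure γ)) (m : ℕ) :
    MemLp (ttFun a b m) 2 ((diskMeasure γ).prod dirMeasure) :=
  (memLp_mul_pow ha m).add (memLp_mul_conj_pow hb m)

lemma modePairing_ttFun {γ : ℝ} (hγ : -1 < γ) {m n : ℕ} (hn : 1 ≤ n) {a b : ℂ → ℂ}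
    (had : DifferentiableOn ℂ a (Metric.ball 0 1)) (ha : MemLp a 2 (diskMeasure γ))
    (hb : MemLp b 2 (diskMeasure γ)) {z : ℂ} (hz : z ∈ Metric.ball (0 : ℂ) 1) :
    modePairing γ n z (ttFun a b m) = if m = n then a z else 0 := by
  have hz1 := mem_ball_zero_iff.1 hz
  have := modePairing_add hγ n hz1 (memLp_mul_pow ha m) (memLp_mul_conj_pow hb m)
  rw [modePairing_conj_pow hγ (by omega) hb hz1, add_zero,
    modePairing_analytic hγ m n had ha hz] at this
  exact this

lemma conj_bundleXray (γ : ℝ) (Φ : ℂ × ℂ → ℂ) (q : ℝ × ℝ) :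
    conj (bundleXray γ Φ q) = bundleXray γ (fun x => conj (Φ x)) q := by
  simp only [bundleXray, intervalIntegral, map_sub, ← integral_conj, map_mul, Complex.conj_ofReal]

lemma fanPairing_conj (γ : ℝ) (u k : ℝ × ℝ → ℂ) :
    fanPairing γ u (fun q => conj (k q)) = conj (fanPairing γ (fun q => conj (u q)) k) := by
  simp only [fanPairing, ← integral_conj, map_mul, Complex.conj_conj]

lemma memLp_conj {α : Type*} {mα : MeasurableSpace α} {μ : Measure α} {g : α → ℂ}
    (hg : MemLp g 2 μ) : MemLp (fun x => conj (g x)) 2 μ :=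
  hg.congr_norm (Complex.continuous_conj.comp_aestronglyMeasurable hg.1)
    (ae_of_all _ fun _ => (Complex.norm_conj _).symm)

lemma memLp_modes {γ : ℝ} {ψ e : ℂ × ℂ → ℂ} {s : Finset ℕ} {a b : ℕ → ℂ → ℂ} {m : ℕ → ℕ}
    (hψ : ψ =ᵐ[(diskMeasure γ).prod dirMeasure] fun x => e x + ∑ i ∈ s, ttFun (a i) (b i) (m i) x)
    (he : MemLp e 2 ((diskMeasure γ).prod dirMeasure))
    (ha : ∀ i ∈ s, MemLp (a i) 2 (diskMeasure γ)) (hb : ∀ i ∈ s, MemLp (b i) 2 (diskMeasure γ)) :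
    MemLp ψ 2 ((diskMeasure γ).prod dirMeasure) :=
  (he.add (memLp_finsetSum s fun i hi => memLp_ttFun (ha i hi) (hb i hi) (m i))).ae_eq hψ.symm

/-- The data of a sum of modes determine the analytic part of the mode of order `n`, when the
remainder `e` is annihilated by the kernel. -/
lemma fanPairing_modes {γ : ℝ} (hγ : -1 < γ) {n : ℕ} (hn : 1 ≤ n) {z : ℂ}
    (hz : z ∈ Metric.ball (0 : ℂ) 1) {ψ e : ℂ × ℂ → ℂ} {s : Finset ℕ} {a b : ℕ → ℂ → ℂ}
    {m : ℕ → ℕ} (hm : Function.Injective m)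
    (hψ : ψ =ᵐ[(diskMeasure γ).prod dirMeasure] fun x => e x + ∑ i ∈ s, ttFun (a i) (b i) (m i) x)
    (he : MemLp e 2 ((diskMeasure γ).prod dirMeasure)) (he0 : modePairing γ n z e = 0)
    (had : ∀ i ∈ s, DifferentiableOn ℂ (a i) (Metric.ball 0 1))
    (ha : ∀ i ∈ s, MemLp (a i) 2 (diskMeasure γ)) (hb : ∀ i ∈ s, MemLp (b i) 2 (diskMeasure γ))
    {j : ℕ} (hj : j ∈ s) (hmj : m j = n) {k : ℝ × ℝ → ℂ}
    (hk : ∀ q t, k q = ((Real.cos q.2 ^ (2 * γ + 1) : ℝ) : ℂ) *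
      (dir q ^ n * bundleKernel γ z (line q t, dir q))) :
    fanPairing γ (bundleXray γ ψ) k = a j z := by
  have hz1 := mem_ball_zero_iff.1 hz
  have htt : ∀ i ∈ s, MemLp (ttFun (a i) (b i) (m i)) 2 ((diskMeasure γ).prod dirMeasure) :=
    fun i hi => memLp_ttFun (ha i hi) (hb i hi) _
  have hsum : MemLp (fun x => ∑ i ∈ s, ttFun (a i) (b i) (m i) x) 2
      ((diskMeasure γ).prod dirMeasure) := memLp_finsetSum s htt
  have hψL := memLp_modes hψ he ha hb
  have h1 := fanPairing_bundleXray (k := k) (Φ := ψ)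
    (K := fun x => x.2 ^ n * bundleKernel γ z x)
    (integrable_mul_mode hγ n hz1 (integrable_of_memLp hγ hψL)) fun q t _ => hk q t
  have h2 : ∫ x, ψ x * conj (x.2 ^ n * bundleKernel γ z x) ∂((diskMeasure γ).prod dirMeasure)
      = modePairing γ n z (fun x => e x + ∑ i ∈ s, ttFun (a i) (b i) (m i) x) := by
    refine integral_congr_ae ?_
    filter_upwards [hψ] with x hx
    rw [hx]
  rw [h1, h2, modePairing_add hγ n hz1 he hsum, he0, zero_add, modePairing_sum hγ n hz1 s htt,
    Finset.sum_eq_single_of_mem j hj]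
  · rw [modePairing_ttFun hγ hn (had j hj) (ha j hj) (hb j hj) hz, if_pos hmj]
  · intro i hi hij
    rw [modePairing_ttFun hγ hn (had i hi) (ha i hi) (hb i hi) hz, if_neg]
    rw [← hmj]
    exact fun h => hij (hm h)

/-- The data of a sum of modes determine both parts of the mode of order `n`. The antianalytic part
is the analytic part of the complex conjugate. -/
theorem fanPairing_modes_both {γ : ℝ} (hγ : -1 < γ) {n : ℕ} (hn : 1 ≤ n) {z : ℂ}
    (hz : z ∈ Metric.ball (0 : ℂ) 1) {ψ e : ℂ × ℂ → ℂ} {s : Finset ℕ} {a b : ℕ → ℂ → ℂ}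
    {m : ℕ → ℕ} (hm : Function.Injective m)
    (hψ : ψ =ᵐ[(diskMeasure γ).prod dirMeasure] fun x => e x + ∑ i ∈ s, ttFun (a i) (b i) (m i) x)
    (he : MemLp e 2 ((diskMeasure γ).prod dirMeasure)) (he0 : modePairing γ n z e = 0)
    (he1 : modePairing γ n z (fun x => conj (e x)) = 0)
    (had : ∀ i ∈ s, DifferentiableOn ℂ (a i) (Metric.ball 0 1))
    (hbd : ∀ i ∈ s, DifferentiableOn ℂ (fun z => conj (b i z)) (Metric.ball 0 1))
    (ha : ∀ i ∈ s, MemLp (a i) 2 (diskMeasure γ)) (hb : ∀ i ∈ s, MemLp (b i) 2 (diskMeasure γ))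
    {j : ℕ} (hj : j ∈ s) (hmj : m j = n) {k : ℝ × ℝ → ℂ}
    (hk : ∀ q t, k q = ((Real.cos q.2 ^ (2 * γ + 1) : ℝ) : ℂ) *
      (dir q ^ n * bundleKernel γ z (line q t, dir q))) :
    fanPairing γ (bundleXray γ ψ) k = a j z ∧
      fanPairing γ (bundleXray γ ψ) (fun q => conj (k q)) = b j z := by
  refine ⟨fanPairing_modes hγ hn hz hm hψ he he0 had ha hb hj hmj hk, ?_⟩
  rw [fanPairing_conj]
  simp only [conj_bundleXray]
  have h := fanPairing_modes (ψ := fun x => conj (ψ x)) (e := fun x => conj (e x))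
    (a := fun i w => conj (b i w)) (b := fun i w => conj (a i w)) hγ hn hz hm ?_ (memLp_conj he)
    he1 hbd (fun i hi => memLp_conj (hb i hi)) (fun i hi => memLp_conj (ha i hi)) hj hmj hk
  · rw [h, Complex.conj_conj]
  · filter_upwards [hψ] with x hx
    rw [hx, map_add, map_sum]
    congr 1
    refine Finset.sum_congr rfl fun i _ => ?_
    simp only [ttFun, map_add, map_mul, map_pow, Complex.conj_conj]
    ring

lemma evalField_tt {m : ℕ} {f : TensorField m} {a b : ℂ → ℂ}
    (h : ∀ z ∈ Metric.ball (0 : ℂ) 1, f z = a z • dzPow m + b z • dzbarPow m)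
    {x : ℂ × ℂ} (hx : x.1 ∈ Metric.ball (0 : ℂ) 1) : evalField f x = ttFun a b m x := by
  rw [evalField, h _ hx, add_apply, smul_apply,
    smul_apply, dzPow_apply_const, dzbarPow_apply_const]
  rfl

/-- A choice of the components of finitely many tt fields. -/
lemma exists_components {γ : ℝ} {m : ℕ → ℕ} {F : (j : ℕ) → TensorField (m j)} {s : Finset ℕ}
    (h : ∀ j ∈ s, (F j).IsTT γ) : ∃ a b : ℕ → ℂ → ℂ,
      (∀ j ∈ s, DifferentiableOn ℂ (a j) (Metric.ball 0 1)) ∧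
      (∀ j ∈ s, MemLp (a j) 2 (diskMeasure γ)) ∧
      (∀ j ∈ s, DifferentiableOn ℂ (fun z => conj (b j z)) (Metric.ball 0 1)) ∧
      (∀ j ∈ s, MemLp (b j) 2 (diskMeasure γ)) ∧
      ∀ j ∈ s, ∀ z ∈ Metric.ball (0 : ℂ) 1,
        F j z = a j z • dzPow (m j) + b j z • dzbarPow (m j) := by
  have h' : ∀ j, ∃ a b : ℂ → ℂ, j ∈ s → DifferentiableOn ℂ a (Metric.ball 0 1) ∧
      MemLp a 2 (diskMeasure γ) ∧ DifferentiableOn ℂ (fun z => conj (b z)) (Metric.ball 0 1) ∧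
      MemLp b 2 (diskMeasure γ) ∧
      ∀ z ∈ Metric.ball (0 : ℂ) 1, F j z = a z • dzPow (m j) + b z • dzbarPow (m j) := fun j => by
    by_cases hj : j ∈ s
    · obtain ⟨a, b, hab⟩ := h j hj
      exact ⟨a, b, fun _ => hab⟩
    · exact ⟨0, 0, fun hj' => absurd hj' hj⟩
  choose a b hab using h'
  exact ⟨a, b, fun j hj => (hab j hj).1, fun j hj => (hab j hj).2.1,
    fun j hj => (hab j hj).2.2.1, fun j hj => (hab j hj).2.2.2.1, fun j hj => (hab j hj).2.2.2.2⟩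

/-- On the unit tangent bundle a field of even order in iterated-tt form is the sum of its modes. -/
lemma evalField_even {γ : ℝ} {p : ℕ} {f : TensorField (2 * p)}
    {F : (j : ℕ) → TensorField (2 * j)} {a b : ℕ → ℂ → ℂ}
    (hf : ∀ᵐ z ∂(diskMeasure γ),
      f z = ∑ j : Fin (p + 1), raise (p - (j : ℕ)) (by have := j.isLt; omega) (F j z))
    (hF : ∀ j ∈ Finset.Ico 1 (p + 1), ∀ z ∈ Metric.ball (0 : ℂ) 1,
      F j z = a j z • dzPow (2 * j) + b j z • dzbarPow (2 * j)) :
    evalField f =ᵐ[(diskMeasure γ).prod dirMeasure] fun x => F 0 x.1 (fun _ => 0) +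
      ∑ i ∈ Finset.Ico 1 (p + 1), ttFun (a i) (b i) (2 * i) x := by
  filter_upwards [ae_bundle γ, Measure.quasiMeasurePreserving_fst.ae hf] with x hx hfx
  have h1 : evalField f x = ∑ j : Fin (p + 1), evalField (F j) x := by
    rw [evalField, hfx, sum_apply]
    exact Finset.sum_congr rfl fun j _ => raise_apply_const _ _ _ hx.2
  rw [h1, Fin.sum_univ_eq_sum_range (fun j => evalField (F j) x), Finset.range_eq_Ico,
    Finset.sum_eq_sum_Ico_succ_bot (Nat.succ_pos p)]
  congr 1
  · rw [evalField]
    congr 1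
    -- The mode of order zero has no arguments.
    funext i
    exact i.elim0
  · exact Finset.sum_congr rfl fun j hj => evalField_tt (hF j hj) hx.1

/-- On the unit tangent bundle a field of odd order in iterated-tt form is the sum of its
potential part and its modes. -/
lemma evalField_odd {γ : ℝ} {p : ℕ} {f : TensorField (2 * p + 1)}
    {F : (j : ℕ) → TensorField (2 * j + 1)} {a b : ℕ → ℂ → ℂ} {dh : ℂ → ℂ →L[ℝ] ℂ}
    (hf : ∀ᵐ z ∂(diskMeasure γ),
      f z = raise p (by omega) (((bdf z ^ (-γ) : ℝ) : ℂ) • hodge (dh z))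
        + ∑ j : Fin (p + 1), raise (p - (j : ℕ)) (by have := j.isLt; omega) (F j z))
    (hF : ∀ j ∈ Finset.range (p + 1), ∀ z ∈ Metric.ball (0 : ℂ) 1,
      F j z = a j z • dzPow (2 * j + 1) + b j z • dzbarPow (2 * j + 1)) :
    evalField f =ᵐ[(diskMeasure γ).prod dirMeasure] fun x => potential γ dh x +
      ∑ i ∈ Finset.range (p + 1), ttFun (a i) (b i) (2 * i + 1) x := by
  filter_upwards [ae_bundle γ, Measure.quasiMeasurePreserving_fst.ae hf] with x hx hfx
  have h1 : evalField f x = potential γ dh x + ∑ j : Fin (p + 1), evalField (F j) x := by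
    rw [evalField, hfx, add_apply, sum_apply, raise_apply_const _ _ _ hx.2, smul_apply,
      hodge_apply_const]
    congr 1
    exact Finset.sum_congr rfl fun j _ => raise_apply_const _ _ _ hx.2
  rw [h1, Fin.sum_univ_eq_sum_range (fun j => evalField (F j) x)]
  congr 1
  exact Finset.sum_congr rfl fun j hj => evalField_tt (hF j hj) hx.1

/-- Reconstruction of the modes of a field of even order. The mode of order zero contributes
nothing, because the kernel has mean value zero in the direction. -/
lemma reconstruction_even {γ : ℝ} (hγ : -1 < γ) (p : ℕ) {f : TensorField (2 * p)}
    {F : (j : ℕ) → TensorField (2 * j)} (h : IsIteratedTTEven γ p f F) :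
    MemLp (xray γ f) 2 (fanMeasure γ) ∧
    ∀ j : ℕ, 1 ≤ j → j ≤ p → ∀ z ∈ Metric.ball (0 : ℂ) 1,
      MemLp (kernel γ j z) 2 (fanMeasure γ) ∧
      F j z = fanPairing γ (xray γ f) (kernel γ j z) • dzPow (2 * j)
        + fanPairing γ (xray γ f) (fun q => conj (kernel γ j z q)) • dzbarPow (2 * j) := by
  obtain ⟨h0, hTT, hf⟩ := h
  obtain ⟨a, b, had, ha, hbd, hb, hF⟩ := exists_components (m := fun j => 2 * j)
    (s := Finset.Ico 1 (p + 1)) (F := F) (γ := γ) fun j hj =>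
      hTT j (Finset.mem_Ico.1 hj).1 (by have := (Finset.mem_Ico.1 hj).2; omega)
  have hψ := evalField_even hf hF
  have hg : MemLp (fun w => F 0 w fun _ => 0) 2 (diskMeasure γ) := h0 _
  have he : MemLp (fun x : ℂ × ℂ => F 0 x.1 fun _ => 0) 2 ((diskMeasure γ).prod dirMeasure) :=
    hg.comp_fst dirMeasure
  rw [xray_eq_bundleXray]
  refine ⟨memLp_bundleXray hγ (memLp_modes hψ he ha hb), fun j hj1 hjp z hz => ?_⟩
  have hz1 := mem_ball_zero_iff.1 hz
  have hjs : j ∈ Finset.Ico 1 (p + 1) := Finset.mem_Ico.2 ⟨hj1, by omega⟩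
  refine ⟨memLp_of_eq_bundleKernel hγ (2 * j) hz1 (kernel_eq γ j z), ?_⟩
  have hvanish : ∀ g : ℂ → ℂ, MemLp g 2 (diskMeasure γ) →
      modePairing γ (2 * j) z (fun x => g x.1) = 0 := fun g hg => by
    simpa using modePairing_conj_pow (m := 0) (n := 2 * j) hγ (by omega) hg hz1
  have hboth := fanPairing_modes_both hγ (n := 2 * j) (by omega) hz (m := fun i => 2 * i)
    (fun i k hik => by simpa using hik) hψ he (hvanish _ hg) (hvanish _ (memLp_conj hg))
    had hbd ha hb hjs rfl (kernel_eq γ j z)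
  rw [hboth.1, hboth.2]
  exact hF j hjs z hz

/-- Reconstruction of the modes of a field of odd order; the potential part is orthogonal to all
kernels. -/
lemma reconstruction_odd {γ : ℝ} (hγ : -1 < γ) (p : ℕ) {f : TensorField (2 * p + 1)}
    {F : (j : ℕ) → TensorField (2 * j + 1)} (h : IsIteratedTTOdd γ p f F) :
    MemLp (xray γ f) 2 (fanMeasure γ) ∧
    ∀ j : ℕ, j ≤ p → ∀ z ∈ Metric.ball (0 : ℂ) 1,
      MemLp (kernelOdd γ j z) 2 (fanMeasure γ) ∧
      F j z = fanPairing γ (xray γ f) (kernelOdd γ j z) • dzPow (2 * j + 1)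
        + fanPairing γ (xray γ f) (fun q => conj (kernelOdd γ j z q))
          • dzbarPow (2 * j + 1) := by
  obtain ⟨hTT, g, dh, hh, hf⟩ := h
  obtain ⟨a, b, had, ha, hbd, hb, hF⟩ := exists_components (m := fun j => 2 * j + 1)
    (s := Finset.range (p + 1)) (F := F) (γ := γ) fun j hj =>
      hTT j (by have := Finset.mem_range.1 hj; omega)
  have hψ := evalField_odd hf hF
  have he := memLp_potential hh
  rw [xray_eq_bundleXray]
  refine ⟨memLp_bundleXray hγ (memLp_modes hψ he ha hb), fun j hjp z hz => ?_⟩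
  have hz1 := mem_ball_zero_iff.1 hz
  have hjs : j ∈ Finset.range (p + 1) := Finset.mem_range.2 (by omega)
  refine ⟨memLp_of_eq_bundleKernel hγ (2 * j + 1) hz1 (kernelOdd_eq γ j z), ?_⟩
  have hboth := fanPairing_modes_both hγ (n := 2 * j + 1) (by omega) hz
    (m := fun i => 2 * i + 1) (fun i k hik => by simpa using hik) hψ he
    (modePairing_potential hγ hh j hz1)
    (by simp only [conj_potential]; exact modePairing_potential hγ hh.conj j hz1)
    had hbd ha hb hjs rfl (kernelOdd_eq γ j z)
  rw [hboth.1, hboth.2]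
  exact hF j hjs z hz

end DiskTensor

end

theorem theorem2p7 (γ : ℝ) (hγ₀ : -1 < γ) (hγ₁ : γ < 1) (p : ℕ) :
    (∀ (f : DiskTensor.TensorField (2 * p)) (F : (j : ℕ) → DiskTensor.TensorField (2 * j)),
      DiskTensor.IsIteratedTTEven γ p f F →
      MemLp (DiskTensor.xray γ f) 2 (DiskTensor.fanMeasure γ) ∧
      ∀ j : ℕ, 1 ≤ j → j ≤ p → ∀ z ∈ Metric.ball (0 : ℂ) 1,
        MemLp (DiskTensor.kernel γ j z) 2 (DiskTensor.fanMeasure γ) ∧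
        F j z =
          DiskTensor.fanPairing γ (DiskTensor.xray γ f) (DiskTensor.kernel γ j z)
              • DiskTensor.dzPow (2 * j)
            + DiskTensor.fanPairing γ (DiskTensor.xray γ f)
                (fun q => conj (DiskTensor.kernel γ j z q))
              • DiskTensor.dzbarPow (2 * j)) ∧
    (∀ (f : DiskTensor.TensorField (2 * p + 1))
      (F : (j : ℕ) → DiskTensor.TensorField (2 * j + 1)),
      DiskTensor.IsIteratedTTOdd γ p f F →
      MemLp (DiskTensor.xray γ f) 2 (DiskTensor.fanMeasure γ) ∧
      ∀ j : ℕ, j ≤ p → ∀ z ∈ Metric.ball (0 : ℂ) 1,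
        MemLp (DiskTensor.kernelOdd γ j z) 2 (DiskTensor.fanMeasure γ) ∧
        F j z =
          DiskTensor.fanPairing γ (DiskTensor.xray γ f) (DiskTensor.kernelOdd γ j z)
              • DiskTensor.dzPow (2 * j + 1)
            + DiskTensor.fanPairing γ (DiskTensor.xray γ f)
                (fun q => conj (DiskTensor.kernelOdd γ j z q))
              • DiskTensor.dzbarPow (2 * j + 1)) := by
  exact ⟨fun _ _ h => DiskTensor.reconstruction_even hγ₀ p h,
    fun _ _ h => DiskTensor.reconstruction_odd hγ₀ p h⟩
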